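/- **Theorem (strong scrambling, sequential circuit).** Let $n\ge 2$ and let $\rho(0)$ be an arbitrary (mixed) state on $n$ qubits. In the sequential random circuit model, each time step independently chooses a uniformly random pair of distinct qubits and applies to it a random two-qubit gate, drawn either from the Haar measure on the two-qubit unitary group $U(4)$ or uniformly from the two-qubit Clifford group (taken modulo global phases). Let $\rho(t)$ be the state after $t$ such steps, and for a set $S$ of qubits let $\rho_S(t)$ be its reduced state on $S$ (the partial trace over the qubits outside $S$). Let $h(x)=-x\log x-(1-x)\log(1-x)$ denote the binary entropy, with all logarithms taken to the same base. For every $k\in\mathbb N$ there is a constant $c>0$ depending only on $k$, and for every $f\in[0,1]$ with $$f\log 3+h(f)-\frac{\log 3}{2}<0$$ there is a constant $C>0$ depending only on $k$ and $f$, such that for both gate distributions, all $n\ge 2$, all initial states $\rho(0)$, all integers $t>c\,n\log^2 n$, and all subsets $S$ of the qubits with $|S|\le fn$, $$\mathbb E\,\mathrm{tr}\big[\rho_S(t)^2\big]\le \frac{1}{2^{|S|}}+\frac{1}{2^{|S|}}\cdot\frac{C}{n^{k}}$$ and $$\mathbb E\,\Big\|\rho_S(t)-\frac{\mathbb 1}{2^{|S|}}\Big\|_1^2\le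 \frac{C}{n^{k}},$$ where the expectation is over the random circuit and $\|A\|_1=\mathrm{tr}\sqrt{A^\dagger A}$ is the trace norm. -/

import Mathlib

open scoped Matrix Kronecker
open MeasureTheory

namespace Scrambling

noncomputable section

/-! ### States, reduced states, trace norm

The space of the qubits labelled by `ι` has the computational basis `ι → Fin 2`; operators on it
are matrices indexed by this basis. -/

open scoped ComplexOrder in
/-- A density operator: positive semidefinite with unit trace. -/
structure IsDensityOperator {d : Type*} [Fintype d] (ρ : Matrix d d ℂ) : Prop where
  posSemidef : ρ.PosSemidef
  trace_eq_one : ρ.trace = 1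

/-- The basis label of all `n` qubits made from a label `a` of the qubits in `S` and a label `c` of
the qubits outside `S`. -/
def joinLabel {n : ℕ} (S : Finset (Fin n)) (a : {i // i ∈ S} → Fin 2) (c : {i // i ∉ S} → Fin 2) :
    Fin n → Fin 2 :=
  fun i => if h : i ∈ S then a ⟨i, h⟩ else c ⟨i, h⟩

/-- The partial trace over all qubits outside `S`. -/
def reducedState {n : ℕ} (S : Finset (Fin n)) (ρ : Matrix (Fin n → Fin 2) (Fin n → Fin 2) ℂ) :
    Matrix ({i // i ∈ S} → Fin 2) ({i // i ∈ S} → Fin 2) ℂ :=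
  Matrix.of fun a b => ∑ c : {i // i ∉ S} → Fin 2, ρ (joinLabel S a c) (joinLabel S b c)

/-- The purity `tr[ρ²]`, a real number for Hermitian `ρ`. -/
def purity {d : Type*} [Fintype d] (ρ : Matrix d d ℂ) : ℝ :=
  (ρ * ρ).trace.re

open scoped MatrixOrder Matrix.Norms.L2Operator in
/-- The trace norm `‖A‖₁ = tr |A|`, where `|A| = √(A† A)`. -/
def traceNorm {d : Type*} [Fintype d] [DecidableEq d] (A : Matrix d d ℂ) : ℝ :=
  (CFC.abs A).trace.re

/-! ### Normalised Haar measure on a compact group -/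

/-- The Haar measure of total mass one on a compact group. -/
def compactHaar (G : Type*) [Group G] [TopologicalSpace G] [IsTopologicalGroup G] [CompactSpace G]
    [MeasurableSpace G] [BorelSpace G] : Measure G :=
  Measure.haarMeasure (⊤ : TopologicalSpace.PositiveCompacts G)

/-! ### Random two-qubit gates -/

/-- The unitary group on two qubits. -/
abbrev TwoQubitUnitary : Type := Matrix.unitaryGroup (Fin 2 × Fin 2) ℂ

instance instMeasurableSpaceTwoQubitUnitary : MeasurableSpace TwoQubitUnitary := borel _

instance instBorelSpaceTwoQubitUnitary : BorelSpace TwoQubitUnitary := ⟨rfl⟩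

instance instCompactSpaceTwoQubitUnitary : CompactSpace TwoQubitUnitary := by
  have hc : IsCompact (Set.univ.pi fun _ : Fin 2 × Fin 2 => Set.univ.pi fun _ : Fin 2 × Fin 2 =>
      Metric.closedBall (0 : ℂ) 1) :=
    isCompact_univ_pi fun _ => isCompact_univ_pi fun _ => isCompact_closedBall _ _
  have hcl : IsClosed
      ((Matrix.unitaryGroup (Fin 2 × Fin 2) ℂ : Set (Matrix (Fin 2 × Fin 2) (Fin 2 × Fin 2) ℂ))) := by
    have : ((Matrix.unitaryGroup (Fin 2 × Fin 2) ℂ :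
        Set (Matrix (Fin 2 × Fin 2) (Fin 2 × Fin 2) ℂ))) = {U | U * star U = 1} := by
      ext U
      exact Matrix.mem_unitaryGroup_iff
    rw [this]
    exact isClosed_eq (by fun_prop) continuous_const
  refine isCompact_iff_compactSpace.mp (IsCompact.of_isClosed_subset hc hcl ?_)
  intro U hU i _ j _
  simpa using entry_norm_bound_of_unitary hU i j

/-- The one-qubit Pauli matrices `σ₀ = 𝟙, σ₁, σ₂, σ₃`. -/
def pauli : Fin 4 → Matrix (Fin 2) (Fin 2) ℂ :=
  ![1, !![0, 1; 1, 0], !![0, -Complex.I; Complex.I, 0], !![1, 0; 0, -1]]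

/-- The two-qubit Pauli operators `± σ_a ⊗ σ_b`. -/
def signedPauli : Set (Matrix (Fin 2 × Fin 2) (Fin 2 × Fin 2) ℂ) :=
  {P | ∃ a b : Fin 4, P = pauli a ⊗ₖ pauli b ∨ P = -(pauli a ⊗ₖ pauli b)}

theorem finite_signedPauli : signedPauli.Finite := by
  have : signedPauli ⊆ (Set.range fun q : Fin 4 × Fin 4 => pauli q.1 ⊗ₖ pauli q.2) ∪
      Set.range fun q : Fin 4 × Fin 4 => -(pauli q.1 ⊗ₖ pauli q.2) := by
    rintro P ⟨a, b, h | h⟩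
    · exact Or.inl ⟨(a, b), h.symm⟩
    · exact Or.inr ⟨(a, b), h.symm⟩
  exact ((Set.finite_range _).union (Set.finite_range _)).subset this

/-- The two-qubit Clifford group: the unitaries such that conjugation by them and by their inverses
maps Pauli operators to Pauli operators up to sign (global phases included). -/
def cliffordGroup : Subgroup TwoQubitUnitary where
  carrier := {U : TwoQubitUnitary | ∀ P ∈ signedPauli,
    U.1 * P * star U.1 ∈ signedPauli ∧ star U.1 * P * U.1 ∈ signedPauli}
  one_mem' := by
    intro P hP
    simpa using hP
  mul_mem' := by
    intro U V hU hV P hP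
    have h1 := (hU _ (hV P hP).1).1
    have h2 := (hV _ (hU P hP).2).2
    constructor
    · simpa [mul_assoc] using h1
    · simpa [mul_assoc] using h2
  inv_mem' := by
    intro U hU P hP
    have h := hU P hP
    exact ⟨by simpa using h.2, by simpa using h.1⟩

instance instCompactSpaceCliffordGroup : CompactSpace cliffordGroup := by
  refine isCompact_iff_compactSpace.mp (IsClosed.isCompact ?_)
  have : (cliffordGroup : Set TwoQubitUnitary) = ⋂ P ∈ signedPauli,
      {U : TwoQubitUnitary | U.1 * P * star U.1 ∈ signedPauli} ∩
        {U : TwoQubitUnitary | star U.1 * P * U.1 ∈ signedPauli} := by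
    ext U
    simp only [Set.mem_iInter, Set.mem_inter_iff, Set.mem_ofPred_eq]
    rfl
  rw [this]
  refine isClosed_biInter fun P _ => IsClosed.inter ?_ ?_
  · exact finite_signedPauli.isClosed.preimage (by fun_prop)
  · exact finite_signedPauli.isClosed.preimage (by fun_prop)

/-- The Haar-random two-qubit gate. -/
def haarGate : Measure TwoQubitUnitary := compactHaar TwoQubitUnitary

/-- The uniformly random two-qubit Clifford gate. The Clifford group is a compact group, finite up to
global phases; its normalised Haar measure induces the uniform distribution on the finite quotient
by the phases, which act trivially on states. -/
def cliffordGate : Measure TwoQubitUnitary :=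
  (compactHaar cliffordGroup).map Subtype.val

/-! ### The sequential random circuit -/

/-- The two-qubit operator `U` acting on qubits `i` and `j` (in this order), as an operator on all
`n` qubits. -/
def gateAt {n : ℕ} (i j : Fin n) (U : Matrix (Fin 2 × Fin 2) (Fin 2 × Fin 2) ℂ) :
    Matrix (Fin n → Fin 2) (Fin n → Fin 2) ℂ :=
  Matrix.of fun x y =>
    if ∀ k, k ≠ i → k ≠ j → x k = y k then U (x i, x j) (y i, y j) else 0

/-- One step of the circuit: a pair of distinct qubits and the gate applied to it. -/
abbrev Step (n : ℕ) : Type := {p : Fin n × Fin n // p.1 < p.2} × TwoQubitUnitary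

/-- The unitary `U_t ⋯ U_1` of a circuit with `t` gates. -/
def circuitUnitary {n : ℕ} : (t : ℕ) → (Fin t → Step n) → Matrix (Fin n → Fin 2) (Fin n → Fin 2) ℂ
  | 0, _ => 1
  | t + 1, ω =>
      gateAt (ω (Fin.last t)).1.1.1 (ω (Fin.last t)).1.1.2 (ω (Fin.last t)).2.1 *
        circuitUnitary t (fun s => ω s.castSucc)

/-- The state `ρ(t)` after the circuit `ω` with `t` gates has acted on `ρ`. -/
def evolvedState {n t : ℕ} (ω : Fin t → Step n) (ρ : Matrix (Fin n → Fin 2) (Fin n → Fin 2) ℂ) :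
    Matrix (Fin n → Fin 2) (Fin n → Fin 2) ℂ :=
  circuitUnitary t ω * ρ * (circuitUnitary t ω)ᴴ

/-- The law of one random step: a uniformly random pair of distinct qubits and an independent gate
with law `μ`. -/
def stepMeasure (n : ℕ) (μ : Measure TwoQubitUnitary) : Measure (Step n) :=
  (ProbabilityTheory.uniformOn Set.univ).prod μ

/-- The law of the sequential random circuit with `t` independent random steps. -/
def circuitMeasure (n t : ℕ) (μ : Measure TwoQubitUnitary) : Measure (Fin t → Step n) :=
  Measure.pi fun _ => stepMeasure n μ

end

end Scrambling

open Scrambling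

/-!
Expanding the state in Pauli strings, the purity of `ρ_S` is `2 ^ (-|S|)` times the sum of the squared
coefficients `|tr (σ_ν ρ)|²` over the strings `ν` supported on `S`, and the trace norm distance to the
maximally mixed state is controlled by the purity through Cauchy–Schwarz. So everything reduces to
bounding the expected squared coefficients on nontrivial strings of weight at most `|S|`.

A gate law that is invariant under left multiplication by Clifford gates (both laws are) replaces each
squared coefficient with a nontrivial restriction to the two qubits of the gate by the average over
the fifteen nontrivial restrictions: the expectation does not depend on the restriction, because the
Clifford group permutes the nontrivial two-qubit Pauli operators transitively up to sign, and the sum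
over all restrictions is a unitary invariant (`IsCliffordInvariant.integral_norm_sq_trace`). Averaged
over the pair of qubits, a function `h` of the weight of a string therefore evolves under the
transition operator `weightStep` of a birth–death chain
(`IsCliffordInvariant.integral_evolvedState`), and one has to bound
`∑ x ≥ 1, w x * lowWeightProb n s t x`, where `w x` is the initial squared weight on strings of weight
`x`. Besides `w x ≤ stringCount n x = 3 ^ x * n.choose x`, one knows that `∑ x, w x ≤ 2 ^ n`.

Two regimes are separated at half filling `r = n / 2`.
* The measure `stringCount` is stationary, so the probability of going from `r` to a weight at most `s`
  is at most `B = ∑ 1 ≤ m ≤ s, stringCount n m / stringCount n r`, and by stochastic monotonicity the same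
  bound holds from every weight above `r`. The entropy condition on `f` says exactly that `2 ^ n * B`
  is exponentially small (`exists_stationary_bound`).
* Below `r` the probability is at most `B + 2 * potential n z x` for an explicit supersolution
  (`lowWeightProb_le_add_potential`). It is a product over `j ≤ x` of ratios that interpolate between
  `1` and about `j / (3 (n - j + 1))`, the inverse growth factor of `stringCount`; the interpolation
  parameter `z` follows a logistic equation with rate of order `1 / (n log n)`, which the drift of the
  chain can support (`relaxRate_mul_le`). Once `z` has become a small power of `1 / n`, after a time of
  order `n log² n`, the product `stringCount n x * potential n z x` is of order `n * z` uniformly in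
  `x` (`stringCount_mul_potential_le_exp`), which finishes the estimate.
-/

namespace Scrambling

/-! ### The weight chain -/

/-- The probability that one random gate raises the weight of a Pauli string from `x` to `x + 1`. -/
noncomputable def upRate (n x : ℕ) : ℝ := 6 * x * (n - x) / (5 * n * (n - 1))

/-- The probability that one random gate lowers the weight of a Pauli string from `x` to `x - 1`. -/
noncomputable def downRate (n x : ℕ) : ℝ := 2 * x * (x - 1) / (5 * n * (n - 1))

/-- The transition operator of the birth–death chain that the weight of a Pauli string performs,
acting on functions of the weight. The truncated `x - 1` is harmless, as `downRate n 0 = 0`. -/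
noncomputable def weightStep (n : ℕ) (h : ℕ → ℝ) (x : ℕ) : ℝ :=
  h x + upRate n x * (h (x + 1) - h x) + downRate n x * (h (x - 1) - h x)

/-- The number of Pauli strings of weight `x` on `n` qubits; the reversible measure of the chain. -/
noncomputable def stringCount (n x : ℕ) : ℝ := 3 ^ x * n.choose x

theorem upRate_nonneg {n x : ℕ} (hx : x ≤ n) : 0 ≤ upRate n x := by
  rcases Nat.eq_zero_or_pos n with rfl | hn
  · simp [upRate]
  · have h1 : (x : ℝ) ≤ n := by exact_mod_cast hx
    have h2 : (1 : ℝ) ≤ n := by exact_mod_cast hn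
    unfold upRate
    apply div_nonneg
    · have : (0 : ℝ) ≤ n - x := by linarith
      positivity
    · have : (0 : ℝ) ≤ n - 1 := by linarith
      positivity

theorem downRate_nonneg (n x : ℕ) : 0 ≤ downRate n x := by
  rcases Nat.eq_zero_or_pos n with rfl | hn
  · simp [downRate]
  rcases Nat.eq_zero_or_pos x with rfl | hx
  · simp [downRate]
  · have h1 : (1 : ℝ) ≤ x := by exact_mod_cast hx
    have h2 : (1 : ℝ) ≤ n := by exact_mod_cast hn
    unfold downRate
    apply div_nonneg
    · have : (0 : ℝ) ≤ x - 1 := by linarith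
      positivity
    · have : (0 : ℝ) ≤ n - 1 := by linarith
      positivity

theorem stringCount_pos {n x : ℕ} (hx : x ≤ n) : 0 < stringCount n x := by
  have : 0 < n.choose x := Nat.choose_pos hx
  unfold stringCount
  positivity

theorem stringCount_nonneg (n x : ℕ) : 0 ≤ stringCount n x := by
  unfold stringCount
  positivity

theorem stringCount_succ (n x : ℕ) :
    stringCount n (x + 1) * (x + 1) = 3 * (n - x) * stringCount n x := by
  rcases le_or_gt x n with hx | hx
  · have h := Nat.choose_succ_right_eq n x
    have h' : (n.choose (x + 1) : ℝ) * (x + 1) = n.choose x * (n - x) := by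
      rw [← Nat.cast_sub hx]
      exact_mod_cast h
    unfold stringCount
    rw [pow_succ]
    linear_combination (3 ^ x * 3 : ℝ) * h'
  · simp [stringCount, Nat.choose_eq_zero_of_lt hx, Nat.choose_eq_zero_of_lt (Nat.lt_succ_of_lt hx)]

/-- Detailed balance for the weight chain. -/
theorem stringCount_mul_upRate (n x : ℕ) :
    stringCount n x * upRate n x = stringCount n (x + 1) * downRate n (x + 1) := by
  unfold upRate downRate
  push_cast
  have h := stringCount_succ n x
  rw [mul_div_assoc', mul_div_assoc']
  congr 1
  linear_combination (-2 * x : ℝ) * h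

/-- `stringCount` is a stationary measure of the chain on the positive weights. -/
theorem sum_stringCount_mul_weightStep (n : ℕ) (h : ℕ → ℝ) :
    ∑ x ∈ Finset.range n, stringCount n (x + 1) * weightStep n h (x + 1) =
      ∑ x ∈ Finset.range n, stringCount n (x + 1) * h (x + 1) := by
  have key : ∀ x, stringCount n (x + 1) * weightStep n h (x + 1) =
      stringCount n (x + 1) * h (x + 1) +
        (stringCount n (x + 1) * upRate n (x + 1) * (h (x + 1 + 1) - h (x + 1)) -
          stringCount n x * upRate n x * (h (x + 1) - h x)) := by
    intro x
    rw [stringCount_mul_upRate n x]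
    unfold weightStep
    simp only [Nat.add_sub_cancel]
    ring
  simp_rw [key]
  rw [Finset.sum_add_distrib,
    Finset.sum_range_sub fun x => stringCount n x * upRate n x * (h (x + 1) - h x)]
  simp [upRate]

theorem upRate_add_downRate_succ_le {n x : ℕ} (hn : 3 ≤ n) (hx : x ≤ n) :
    upRate n x + downRate n (x + 1) ≤ 1 := by
  have h1 : (x : ℝ) ≤ n := by exact_mod_cast hx
  have h2 : (3 : ℝ) ≤ n := by exact_mod_cast hn
  unfold upRate downRate
  rw [← add_div, div_le_one (by nlinarith)]
  push_cast
  nlinarith [sq_nonneg (4 * (x : ℝ) - (3 * n + 1)), mul_nonneg (by linarith : (0 : ℝ) ≤ n - 3)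
    (by linarith : (0 : ℝ) ≤ n)]

theorem upRate_add_downRate_le {n x : ℕ} (hn : 3 ≤ n) (hx : x ≤ n) :
    upRate n x + downRate n x ≤ 1 := by
  refine le_trans ?_ (upRate_add_downRate_succ_le hn hx)
  have h2 : (3 : ℝ) ≤ n := by exact_mod_cast hn
  have h0 : (0 : ℝ) ≤ x := Nat.cast_nonneg x
  unfold downRate
  gcongr _ + ?_ / _
  · have : (0 : ℝ) ≤ n - 1 := by linarith
    positivity
  · push_cast
    nlinarith

theorem downRate_one (n : ℕ) : downRate n 1 = 0 := by simp [downRate]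

theorem downRate_zero (n : ℕ) : downRate n 0 = 0 := by simp [downRate]

theorem upRate_zero (n : ℕ) : upRate n 0 = 0 := by simp [upRate]

theorem upRate_self (n : ℕ) : upRate n n = 0 := by simp [upRate]

/-- At an interior site the step is monotone; the state `0` is never reached from a positive
weight, so its value is irrelevant. -/
theorem weightStep_le_weightStep {n x : ℕ} (hn : 3 ≤ n) (hx : x ≤ n) {g h : ℕ → ℝ}
    (h0 : g x ≤ h x) (h1 : x < n → g (x + 1) ≤ h (x + 1)) (h2 : 2 ≤ x → g (x - 1) ≤ h (x - 1)) :
    weightStep n g x ≤ weightStep n h x := by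
  have e1 : upRate n x * g (x + 1) ≤ upRate n x * h (x + 1) := by
    rcases hx.lt_or_eq with h | rfl
    · exact mul_le_mul_of_nonneg_left (h1 h) (upRate_nonneg hx)
    · simp [upRate_self]
  have e2 : downRate n x * g (x - 1) ≤ downRate n x * h (x - 1) := by
    rcases lt_or_ge x 2 with h | h
    · interval_cases x <;> simp [downRate_zero, downRate_one]
    · exact mul_le_mul_of_nonneg_left (h2 h) (downRate_nonneg n x)
  have e3 : (1 - upRate n x - downRate n x) * g x ≤ (1 - upRate n x - downRate n x) * h x :=
    mul_le_mul_of_nonneg_left h0 (by linarith [upRate_add_downRate_le hn hx])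
  unfold weightStep
  linarith

theorem weightStep_add_mul (n x : ℕ) (a b : ℝ) (h : ℕ → ℝ) :
    weightStep n (fun y => a + b * h y) x = a + b * weightStep n h x := by
  unfold weightStep
  ring

theorem weightStep_const (n x : ℕ) (a : ℝ) : weightStep n (fun _ => a) x = a := by
  simp [weightStep]

/-- The chain is stochastically monotone. -/
theorem weightStep_antitone {n : ℕ} (hn : 3 ≤ n) {h : ℕ → ℝ}
    (hh : ∀ x < n, h (x + 1) ≤ h x) : ∀ x < n, weightStep n h (x + 1) ≤ weightStep n h x := by
  intro x hx
  have h1 := upRate_add_downRate_succ_le hn hx.le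
  have e1 : 0 ≤ (1 - upRate n x - downRate n (x + 1)) * (h x - h (x + 1)) :=
    mul_nonneg (by linarith) (by linarith [hh x hx])
  have e2 : 0 ≤ upRate n (x + 1) * (h (x + 1) - h (x + 1 + 1)) := by
    rcases (Nat.succ_le_of_lt hx).lt_or_eq with h2 | h2
    · exact mul_nonneg (upRate_nonneg (Nat.succ_le_of_lt hx)) (by linarith [hh (x + 1) h2])
    · have h3 : x + 1 = n := h2
      rw [h3, upRate_self]
      simp
  have e3 : 0 ≤ downRate n x * (h (x - 1) - h x) := by
    rcases Nat.eq_zero_or_pos x with rfl | h2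
    · simp
    · refine mul_nonneg (downRate_nonneg n x) ?_
      have := hh (x - 1) (by omega)
      rw [Nat.sub_add_cancel h2] at this
      linarith
  unfold weightStep
  simp only [Nat.add_sub_cancel]
  linarith

/-- The probability that the weight chain, started at `x`, has weight at most `s` after `t` steps,
as a function of `x`. -/
noncomputable def lowWeightProb (n s t : ℕ) : ℕ → ℝ :=
  (weightStep n)^[t] fun x => if x ≤ s then 1 else 0

theorem lowWeightProb_zero (n s x : ℕ) : lowWeightProb n s 0 x = if x ≤ s then 1 else 0 := rfl

theorem lowWeightProb_succ (n s t : ℕ) :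
    lowWeightProb n s (t + 1) = weightStep n (lowWeightProb n s t) :=
  Function.iterate_succ_apply' _ _ _

theorem lowWeightProb_succ_apply (n s t x : ℕ) :
    lowWeightProb n s (t + 1) x = weightStep n (lowWeightProb n s t) x := by
  rw [lowWeightProb_succ]

theorem lowWeightProb_nonneg {n s : ℕ} (hn : 3 ≤ n) (t : ℕ) :
    ∀ x ≤ n, 0 ≤ lowWeightProb n s t x := by
  induction t with
  | zero => intro x _; rw [lowWeightProb_zero]; split_ifs <;> norm_num
  | succ t ih =>
    intro x hx
    rw [lowWeightProb_succ_apply, ← weightStep_const n x 0]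
    exact weightStep_le_weightStep hn hx (ih x hx) (fun h => ih _ h) (fun _ => ih _ (by omega))

theorem lowWeightProb_antitone {n s : ℕ} (hn : 3 ≤ n) (t : ℕ) :
    ∀ x < n, lowWeightProb n s t (x + 1) ≤ lowWeightProb n s t x := by
  induction t with
  | zero =>
    intro x _
    rw [lowWeightProb_zero, lowWeightProb_zero]
    split_ifs with h1 h2 <;> first | omega | norm_num
  | succ t ih => rw [lowWeightProb_succ]; exact weightStep_antitone hn ih

theorem lowWeightProb_le_of_le {n s : ℕ} (hn : 3 ≤ n) (t : ℕ) {r x : ℕ} (hr : r ≤ x) (hx : x ≤ n) :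
    lowWeightProb n s t x ≤ lowWeightProb n s t r := by
  induction x, hr using Nat.le_induction with
  | base => exact le_rfl
  | succ y _ ih => exact (lowWeightProb_antitone hn t y hx).trans (ih (by omega))

/-- Stationarity of `stringCount` bounds the probability of ending at a low weight. -/
theorem lowWeightProb_le_sum_div {n s r : ℕ} (hn : 3 ≤ n) (t : ℕ) (hr : 1 ≤ r) (hrn : r ≤ n)
    (hs : s ≤ n) :
    lowWeightProb n s t r ≤ (∑ m ∈ Finset.range s, stringCount n (m + 1)) / stringCount n r := by
  have hsum : ∑ x ∈ Finset.range n, stringCount n (x + 1) * lowWeightProb n s t (x + 1) =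
      ∑ m ∈ Finset.range s, stringCount n (m + 1) := by
    induction t with
    | zero =>
      simp only [lowWeightProb_zero, mul_ite, mul_one, mul_zero]
      rw [← Finset.sum_filter]
      congr 1
      ext x
      simp only [Finset.mem_filter, Finset.mem_range]
      omega
    | succ t ih =>
      rw [lowWeightProb_succ, sum_stringCount_mul_weightStep, ih]
  rw [le_div_iff₀ (stringCount_pos hrn), ← hsum, mul_comm]
  have h := Finset.single_le_sum (f := fun x => stringCount n (x + 1) * lowWeightProb n s t (x + 1))
    (s := Finset.range n) (fun x hx => mul_nonneg (stringCount_nonneg _ _)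
      (lowWeightProb_nonneg hn t _ (by simp at hx; omega)))
    (show r - 1 ∈ Finset.range n by simp; omega)
  simpa [Nat.sub_add_cancel hr] using h

/-! ### A supersolution of the weight chain below half filling -/

/-- The limiting decay factor of the supersolution between the weights `j - 1` and `j`. It is
slightly larger than `stringCount n (j - 1) / stringCount n j = j / (3 * (n - j + 1))`, and is set to `0`
at `j = 1`, so that the supersolution vanishes in the limit `z → 0`. -/
noncomputable def baseRatio (n j : ℕ) : ℝ := if j ≤ 1 then 0 else j / (3 * (n - j - 1))

/-- The interpolation between `1` (at `z = 1`) and `baseRatio` (at `z = 0`). -/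
noncomputable def interpRatio (n : ℕ) (z : ℝ) (j : ℕ) : ℝ := z + (1 - z) * baseRatio n j

/-- The supersolution, as the product of the ratios of its consecutive values. -/
noncomputable def potential (n : ℕ) (z : ℝ) (x : ℕ) : ℝ :=
  ∏ j ∈ Finset.range x, interpRatio n z (j + 1)

theorem potential_succ (n : ℕ) (z : ℝ) (x : ℕ) :
    potential n z (x + 1) = potential n z x * interpRatio n z (x + 1) :=
  Finset.prod_range_succ _ _

theorem baseRatio_nonneg {n j : ℕ} (hj : 2 * j ≤ n) : 0 ≤ baseRatio n j := by
  unfold baseRatio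
  split_ifs with h
  · exact le_rfl
  · have h1 : (2 : ℝ) * j ≤ n := by exact_mod_cast hj
    have h2 : (2 : ℝ) ≤ j := by exact_mod_cast (by omega : 2 ≤ j)
    apply div_nonneg <;> linarith

theorem baseRatio_le {n j : ℕ} (hj : 2 * j ≤ n) : baseRatio n j ≤ 2 / 3 := by
  unfold baseRatio
  split_ifs with h
  · norm_num
  · have h1 : (2 : ℝ) * j ≤ n := by exact_mod_cast hj
    have h2 : (2 : ℝ) ≤ j := by exact_mod_cast (by omega : 2 ≤ j)
    rw [div_le_iff₀ (by linarith)]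
    linarith

theorem baseRatio_le_third {n j : ℕ} (hj : 2 * j + 2 ≤ n) : baseRatio n j ≤ 1 / 3 := by
  unfold baseRatio
  split_ifs with h
  · norm_num
  · have h1 : (2 : ℝ) * j + 2 ≤ n := by exact_mod_cast hj
    have h2 : (2 : ℝ) ≤ j := by exact_mod_cast (by omega : 2 ≤ j)
    rw [div_le_iff₀ (by linarith)]
    linarith

theorem one_sub_sum_le_prod {ι : Type*} (s : Finset ι) (a : ι → ℝ) (h0 : ∀ i ∈ s, 0 ≤ a i)
    (h1 : ∀ i ∈ s, a i ≤ 1) : 1 - ∑ i ∈ s, a i ≤ ∏ i ∈ s, (1 - a i) := by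
  classical
  induction s using Finset.induction_on with
  | empty => simp
  | insert i s hi ih =>
    rw [Finset.sum_insert hi, Finset.prod_insert hi]
    have h2 := ih (fun j hj => h0 j (Finset.mem_insert_of_mem hj))
      (fun j hj => h1 j (Finset.mem_insert_of_mem hj))
    have h3 := h0 i (Finset.mem_insert_self i s)
    have h4 := h1 i (Finset.mem_insert_self i s)
    have h5 : 0 ≤ ∑ j ∈ s, a j :=
      Finset.sum_nonneg fun j hj => h0 j (Finset.mem_insert_of_mem hj)
    nlinarith [mul_le_mul_of_nonneg_left h2 (by linarith : 0 ≤ 1 - a i)]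

/-- The relaxation rate of the supersolution. The logarithm bounds a harmonic sum in
`relaxRate_mul_le`, where the constant `40` is also used. -/
noncomputable def relaxRate (n : ℕ) : ℝ := 1 / (40 * n * (1 + Real.log n))

theorem sum_inv_le (n x : ℕ) (hx : x ≤ n) :
    ∑ j ∈ Finset.range x, (1 : ℝ) / (j + 1) ≤ 1 + Real.log n := by
  have h1 := harmonic_le_one_add_log n
  refine le_trans ?_ h1
  unfold harmonic
  push_cast
  refine (Finset.sum_le_sum_of_subset_of_nonneg (Finset.range_mono hx) ?_).trans_eq ?_
  · intros; positivity
  · simp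

theorem relaxRate_pos {n : ℕ} (hn : 1 ≤ n) : 0 < relaxRate n := by
  have h1 : (1 : ℝ) ≤ n := by exact_mod_cast hn
  have := Real.log_nonneg h1
  unfold relaxRate
  positivity

theorem relaxRate_le_one {n : ℕ} (hn : 1 ≤ n) : relaxRate n ≤ 1 := by
  have h1 : (1 : ℝ) ≤ n := by exact_mod_cast hn
  have := Real.log_nonneg h1
  unfold relaxRate
  rw [div_le_one (by positivity)]
  nlinarith

/-- The rate at which the chain lowers the fully relaxed supersolution (`z = 0`) at `x`, multiplied by
`5 n (n - 1) / 2`. This is where the choice of `baseRatio` and the restriction to half filling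
matter: with the exact inverse growth factor of `stringCount`, which has `n - j + 1` in place of
`n - j - 1`, the drift would have the wrong sign between `3 n / 8` and `n / 2`. -/
theorem drift_lower_bound {n x : ℝ} (hx : 1 ≤ x) (hn : 2 * x + 2 ≤ n) :
    n - 1 ≤ 3 * x * (n - x) * (1 - (x + 1) / (3 * (n - (x + 1) - 1))) -
      (x - 1) * (3 * (n - x - 1) - x) := by
  have hy : 0 < n - (x + 1) - 1 := by linarith
  have key : 2 * x * (x + 1) / (n - (x + 1) - 1) ≤ 2 * n - 2 * x - 2 := by
    rw [div_le_iff₀ hy]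
    nlinarith
  have e : 3 * x * (n - x) * (1 - (x + 1) / (3 * (n - (x + 1) - 1))) =
      3 * x * (n - x) - x * (x + 1) - 2 * x * (x + 1) / (n - (x + 1) - 1) := by
    field_simp
    ring
  rw [e]
  nlinarith

/-- Splits the drift into its value at full relaxation and a surplus proportional to `z`. -/
theorem drift_split {a g M X Y z θ ρ : ℝ} (hX : θ * (3 * M) = X) (hρ : ρ = z + (1 - z) * θ)
    (hρ0 : ρ ≠ 0) :
    a * g - a * (X * Y) * ((1 - θ) / ρ) =
      a * (g - Y * (3 * M - X)) + a * (3 * Y * M * (1 - θ) ^ 2 * z / ρ) := by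
  subst hX
  field_simp
  rw [hρ]
  ring

theorem relaxRate_surplus_le {a n y : ℝ} (hn : 0 < n) (hy : 1 ≤ y) (ha : 2 / (5 * n * n) ≤ a) :
    1 / (40 * n) * (2 * (y + 1)) ≤ a * (2 / 3 * y * n) := by
  have h1 : 2 / (5 * n * n) * (2 / 3 * y * n) ≤ a * (2 / 3 * y * n) := by gcongr
  have h2 : 2 / (5 * n * n) * (2 / 3 * y * n) = 4 * y / (15 * n) := by field_simp; norm_num
  have h3 : 1 / (40 * n) * (2 * (y + 1)) = (y + 1) / (20 * n) := by field_simp; norm_num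
  have h4 : (y + 1) / (20 * n) ≤ 4 * y / (15 * n) := by
    rw [div_le_div_iff₀ (by positivity) (by positivity)]
    nlinarith
  linarith

/-- The rate inequality behind `weightStep_potential_le`: the relaxation of the ratios below `x` is
paid for by the drift at `x`. -/
theorem relaxRate_mul_le {n x : ℕ} (hx : 1 ≤ x) (hn : 2 * x + 2 ≤ n) {z : ℝ} (hz0 : 0 < z)
    (hz1 : z < 1) :
    relaxRate n * (z * ∑ j ∈ Finset.range x, (1 - baseRatio n (j + 1)) / interpRatio n z (j + 1)) ≤
      upRate n x * (1 - baseRatio n (x + 1)) -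
        downRate n x * ((1 - baseRatio n x) / interpRatio n z x) := by
  have hnR : 2 * (x : ℝ) + 2 ≤ n := by exact_mod_cast hn
  have hxR : (1 : ℝ) ≤ x := by exact_mod_cast hx
  have hL : 0 ≤ Real.log n := Real.log_nonneg (by linarith)
  have hδ := relaxRate_pos (n := n) (by omega)
  set δ := relaxRate n with hδdef
  have hδL : δ * (1 + Real.log n) * (40 * n) = 1 := by
    have : (0 : ℝ) < n := by linarith
    rw [hδdef, relaxRate]
    field_simp
  clear_value δ
  have hρpos : ∀ j, 2 * j ≤ n → 0 < interpRatio n z j := fun j hj => by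
    have := baseRatio_nonneg hj
    unfold interpRatio
    nlinarith
  -- the term `j = 1` of the sum is `1 / z`, because `baseRatio n 1 = 0`; it is split off
  obtain ⟨y, rfl⟩ : ∃ y, x = y + 1 := ⟨x - 1, by omega⟩
  rw [Finset.sum_range_succ']
  have hb1 : baseRatio n (0 + 1) = 0 := by simp [baseRatio]
  have hr1 : interpRatio n z (0 + 1) = z := by simp [interpRatio, hb1]
  rw [hb1, hr1, mul_add, sub_zero, mul_one_div_cancel hz0.ne', mul_add, mul_one]
  push_cast at hnR hxR ⊢
  have hD := drift_lower_bound (n := (n : ℝ)) (x := (y : ℝ) + 1) hxR hnR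
  have hbs : baseRatio n (y + 1 + 1) = ((y : ℝ) + 1 + 1) / (3 * (n - ((y : ℝ) + 1 + 1) - 1)) := by
    simp [baseRatio]
  have hup : upRate n (y + 1) = 2 / (5 * n * (n - 1)) * (3 * ((y : ℝ) + 1) * (n - ((y : ℝ) + 1))) := by
    unfold upRate; push_cast; ring
  have hdown : downRate n (y + 1) = 2 / (5 * n * (n - 1)) * (((y : ℝ) + 1) * y) := by
    unfold downRate; push_cast; ring
  have hα : 0 < 2 / (5 * (n : ℝ) * (n - 1)) := by
    have : (0 : ℝ) < n := by linarith
    have : (0 : ℝ) < n - 1 := by linarith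
    positivity
  set α := 2 / (5 * (n : ℝ) * (n - 1)) with hαdef
  have hαn : α * (5 * n * (n - 1)) = 2 := by
    rw [hαdef, div_mul_cancel₀]
    have : (0 : ℝ) < n := by linarith
    have : (0 : ℝ) < n - 1 := by linarith
    positivity
  have hα1 : 2 / (5 * (n : ℝ) * n) ≤ α := by
    rw [hαdef]
    have : (0 : ℝ) < n - 1 := by linarith
    have : (0 : ℝ) < n := by linarith
    gcongr
    linarith
  clear_value α
  have hδα : δ ≤ α * (n - 1) := by
    have h1 : δ * (40 * n) ≤ 1 := by
      have : 0 ≤ δ * Real.log n * (40 * n) := by positivity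
      linarith
    have h2 : (α * (n - 1)) * (40 * n) = 16 := by linear_combination 8 * hαn
    by_contra hcon
    push Not at hcon
    have : (α * (n - 1)) * (40 * n) < δ * (40 * n) :=
      mul_lt_mul_of_pos_right hcon (by linarith)
    linarith
  rcases Nat.eq_zero_or_pos y with rfl | hy
  · rw [hup, hdown, hbs]
    simp only [Finset.range_zero, Finset.sum_empty, mul_zero, zero_add, Nat.cast_zero, zero_mul,
      sub_zero] at hD ⊢
    have := mul_le_mul_of_nonneg_left hD hα.le
    simp only [sub_self, zero_mul, sub_zero] at this
    linarith
  have hyR : (1 : ℝ) ≤ y := by exact_mod_cast hy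
  have hbx : baseRatio n (y + 1) = ((y : ℝ) + 1) / (3 * (n - ((y : ℝ) + 1) - 1)) := by
    have : ¬ (y + 1 ≤ 1) := by omega
    simp [baseRatio]
    omega
  have hbx3 := baseRatio_le_third (n := n) (j := y + 1) hn
  have hbx0 : 0 < baseRatio n (y + 1) := by
    rw [hbx]
    apply div_pos <;> linarith
  have hρx := hρpos (y + 1) (by omega)
  -- every ratio is at least `j / (2 x)` times the last one
  have hcomp : ∀ j < y, (1 - baseRatio n (j + 1 + 1)) / interpRatio n z (j + 1 + 1) ≤
      2 * ((y : ℝ) + 1) / interpRatio n z (y + 1) * (1 / ((j : ℝ) + 1 + 1)) := by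
    intro j hj
    have hjR : (j : ℝ) + 1 ≤ y := by exact_mod_cast hj
    have hj0 : (0 : ℝ) ≤ j := Nat.cast_nonneg j
    have hρj := hρpos (j + 1 + 1) (by omega)
    have hbj : baseRatio n (j + 1 + 1) = ((j : ℝ) + 1 + 1) / (3 * (n - ((j : ℝ) + 1 + 1) - 1)) := by
      simp [baseRatio]
    have hbj0 := baseRatio_nonneg (n := n) (j := j + 1 + 1) (by omega)
    have hθ : ((j : ℝ) + 1 + 1) * baseRatio n (y + 1) ≤
        2 * ((y : ℝ) + 1) * baseRatio n (j + 1 + 1) := by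
      rw [hbx, hbj, mul_div_assoc', mul_div_assoc', div_le_div_iff₀ (by linarith) (by linarith)]
      have : (n : ℝ) - ((j : ℝ) + 1 + 1) - 1 ≤ 2 * (n - ((y : ℝ) + 1) - 1) := by linarith
      have h2 : 0 ≤ ((j : ℝ) + 1 + 1) * ((y : ℝ) + 1) := by positivity
      linarith [mul_le_mul_of_nonneg_left this h2]
    have hρ : ((j : ℝ) + 1 + 1) * interpRatio n z (y + 1) ≤
        2 * ((y : ℝ) + 1) * interpRatio n z (j + 1 + 1) := by
      unfold interpRatio
      have h3 := mul_le_mul_of_nonneg_left hθ (by linarith : 0 ≤ 1 - z)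
      have h4 : ((j : ℝ) + 1 + 1) * z ≤ 2 * ((y : ℝ) + 1) * z :=
        mul_le_mul_of_nonneg_right (by linarith) hz0.le
      linarith
    calc (1 - baseRatio n (j + 1 + 1)) / interpRatio n z (j + 1 + 1)
        ≤ 1 / interpRatio n z (j + 1 + 1) := by gcongr; linarith
      _ ≤ _ := by
        rw [div_mul_div_comm, mul_one, div_le_div_iff₀ hρj (by positivity)]
        linarith
  have hsum : ∑ j ∈ Finset.range y, (1 - baseRatio n (j + 1 + 1)) / interpRatio n z (j + 1 + 1) ≤
      2 * ((y : ℝ) + 1) / interpRatio n z (y + 1) * (1 + Real.log n) := by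
    refine (Finset.sum_le_sum fun j hj => hcomp j (Finset.mem_range.mp hj)).trans ?_
    rw [← Finset.mul_sum]
    gcongr
    refine (Finset.sum_le_sum fun j _ => ?_).trans (sum_inv_le n y (by omega))
    gcongr
    linarith
  -- the drift splits into its value at full relaxation and a surplus proportional to `z`
  have hsplit : upRate n (y + 1) * (1 - baseRatio n (y + 1 + 1)) -
      downRate n (y + 1) * ((1 - baseRatio n (y + 1)) / interpRatio n z (y + 1)) =
      α * (3 * ((y : ℝ) + 1) * (n - ((y : ℝ) + 1)) * (1 - baseRatio n (y + 1 + 1)) -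
        y * (3 * (n - ((y : ℝ) + 1) - 1) - ((y : ℝ) + 1))) +
      α * (3 * y * (n - ((y : ℝ) + 1) - 1) * (1 - baseRatio n (y + 1)) ^ 2 * z /
        interpRatio n z (y + 1)) := by
    have hN : baseRatio n (y + 1) * (3 * (n - ((y : ℝ) + 1) - 1)) = (y : ℝ) + 1 := by
      rw [hbx, div_mul_cancel₀]
      have : 0 < 3 * ((n : ℝ) - ((y : ℝ) + 1) - 1) := by linarith
      exact this.ne'
    rw [hup, hdown, mul_assoc α]
    exact drift_split hN rfl hρx.ne'
  rw [hsplit, add_comm]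
  refine add_le_add (hδα.trans ?_) ?_
  · rw [hbs]
    refine mul_le_mul_of_nonneg_left ?_ hα.le
    simpa using hD
  · have e1 : δ * (z * ∑ j ∈ Finset.range y,
        (1 - baseRatio n (j + 1 + 1)) / interpRatio n z (j + 1 + 1)) ≤
        δ * (z * (2 * ((y : ℝ) + 1) / interpRatio n z (y + 1) * (1 + Real.log n))) := by
      gcongr
    refine e1.trans ?_
    have e2 : δ * (z * (2 * ((y : ℝ) + 1) / interpRatio n z (y + 1) * (1 + Real.log n))) =
        (δ * (1 + Real.log n)) * (2 * ((y : ℝ) + 1)) * (z / interpRatio n z (y + 1)) := by ring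
    have e3 : α * (3 * y * (n - ((y : ℝ) + 1) - 1) * (1 - baseRatio n (y + 1)) ^ 2 * z /
        interpRatio n z (y + 1)) = α * (3 * y * (n - ((y : ℝ) + 1) - 1) *
          (1 - baseRatio n (y + 1)) ^ 2) * (z / interpRatio n z (y + 1)) := by ring
    rw [e2, e3]
    refine mul_le_mul_of_nonneg_right ?_ (by positivity)
    have e4 : (4 / 9 : ℝ) ≤ (1 - baseRatio n (y + 1)) ^ 2 := by
      have := pow_le_pow_left₀ (by norm_num) (by linarith : (2 / 3 : ℝ) ≤ 1 - baseRatio n (y + 1)) 2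
      linarith
    have e5 : (2 / 3 : ℝ) * y * n ≤ 3 * y * (n - ((y : ℝ) + 1) - 1) *
        (1 - baseRatio n (y + 1)) ^ 2 := by
      have h1 : (3 / 2 : ℝ) * y * n ≤ 3 * y * (n - ((y : ℝ) + 1) - 1) := by
        linarith [mul_le_mul_of_nonneg_left
          (by linarith : (n : ℝ) / 2 ≤ n - ((y : ℝ) + 1) - 1) (by linarith : (0 : ℝ) ≤ 3 * y)]
      calc (2 / 3 : ℝ) * y * n = (3 / 2 * y * n) * (4 / 9) := by ring
        _ ≤ _ := mul_le_mul h1 e4 (by norm_num) (le_trans (by positivity) h1)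
    refine le_trans ?_ (mul_le_mul_of_nonneg_left e5 hα.le)
    have hδ1 : δ * (1 + Real.log n) = 1 / (40 * n) := by
      rw [eq_div_iff (by linarith)]; exact hδL
    rw [hδ1]
    exact relaxRate_surplus_le (by linarith) hyR hα1

theorem interpRatio_pos {n j : ℕ} (hj : 2 * j ≤ n) {z : ℝ} (hz0 : 0 < z) (hz1 : z ≤ 1) :
    0 < interpRatio n z j := by
  have := baseRatio_nonneg hj
  unfold interpRatio
  have : 0 ≤ (1 - z) * baseRatio n j := mul_nonneg (by linarith) this
  linarith

theorem potential_pos {n x : ℕ} (hx : 2 * x ≤ n) {z : ℝ} (hz0 : 0 < z) (hz1 : z ≤ 1) :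
    0 < potential n z x :=
  Finset.prod_pos fun j hj => interpRatio_pos (by simp at hj; omega) hz0 hz1

/-- `potential` is a supersolution below half filling, for every schedule of `z` that decreases no
faster than the logistic equation with rate `relaxRate n`. -/
theorem weightStep_potential_le {n x : ℕ} (hx : 1 ≤ x) (hn : 2 * x + 2 ≤ n) {z z' : ℝ}
    (hz0 : 0 < z) (hz1 : z < 1) (hz' : 0 < z') (hle : z' ≤ z)
    (hstep : z - z' ≤ relaxRate n * (z * (1 - z))) :
    weightStep n (potential n z) x ≤ potential n z' x := by
  have hρ : ∀ j, 2 * j ≤ n → 0 < interpRatio n z j := fun j hj => interpRatio_pos hj hz0 hz1.le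
  have hpos := potential_pos (n := n) (x := x) (by omega) hz0 hz1.le
  set a : ℕ → ℝ := fun j => (z - z') * ((1 - baseRatio n (j + 1)) / interpRatio n z (j + 1)) with ha
  have hfac : ∀ j < x, interpRatio n z' (j + 1) = interpRatio n z (j + 1) * (1 - a j) := by
    intro j hj
    have h := (hρ (j + 1) (by omega)).ne'
    have h1 : interpRatio n z (j + 1) * a j = (z - z') * (1 - baseRatio n (j + 1)) := by
      simp only [ha]
      field_simp
    rw [mul_sub, h1]
    unfold interpRatio
    ring
  have hprod : potential n z' x = potential n z x * ∏ j ∈ Finset.range x, (1 - a j) := by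
    unfold potential
    rw [← Finset.prod_mul_distrib]
    exact Finset.prod_congr rfl fun j hj => hfac j (Finset.mem_range.mp hj)
  have hlow : 1 - ∑ j ∈ Finset.range x, a j ≤ ∏ j ∈ Finset.range x, (1 - a j) := by
    apply one_sub_sum_le_prod
    · intro j hj
      have hj' := Finset.mem_range.mp hj
      have h1 := baseRatio_le (n := n) (j := j + 1) (by omega)
      exact mul_nonneg (by linarith) (div_nonneg (by linarith) (hρ _ (by omega)).le)
    · intro j hj
      have hj' := Finset.mem_range.mp hj
      have h1 := interpRatio_pos (n := n) (j := j + 1) (by omega) hz' (hle.trans hz1.le)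
      rw [hfac j hj'] at h1
      have := pos_of_mul_pos_right h1 (hρ _ (by omega)).le
      linarith
  have hsum : ∑ j ∈ Finset.range x, a j ≤ (1 - z) * (upRate n x * (1 - baseRatio n (x + 1)) -
        downRate n x * ((1 - baseRatio n x) / interpRatio n z x)) := by
    simp only [ha]
    rw [← Finset.mul_sum]
    have hS : 0 ≤ ∑ j ∈ Finset.range x, (1 - baseRatio n (j + 1)) / interpRatio n z (j + 1) := by
      refine Finset.sum_nonneg fun j hj => ?_
      have hj' := Finset.mem_range.mp hj
      have h1 := baseRatio_le (n := n) (j := j + 1) (by omega)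
      exact div_nonneg (by linarith) (hρ _ (by omega)).le
    have h1 := mul_le_mul_of_nonneg_right hstep hS
    have h2 := mul_le_mul_of_nonneg_left (relaxRate_mul_le hx hn hz0 hz1) (by linarith : 0 ≤ 1 - z)
    linarith
  have hws : weightStep n (potential n z) x = potential n z x *
      (1 - (1 - z) * (upRate n x * (1 - baseRatio n (x + 1)) -
        downRate n x * ((1 - baseRatio n x) / interpRatio n z x))) := by
    obtain ⟨y, rfl⟩ : ∃ y, x = y + 1 := ⟨x - 1, by omega⟩
    have h := (hρ (y + 1) (by omega)).ne'
    have hy : potential n z y = potential n z (y + 1) / interpRatio n z (y + 1) := by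
      rw [potential_succ]
      field_simp
    have hy' : (1 - interpRatio n z (y + 1)) = (1 - z) * (1 - baseRatio n (y + 1)) := by
      unfold interpRatio
      ring
    unfold weightStep
    rw [potential_succ n z (y + 1), Nat.add_sub_cancel, hy]
    have h3 : potential n z (y + 1) / interpRatio n z (y + 1) - potential n z (y + 1) =
        potential n z (y + 1) * (((1 - z) * (1 - baseRatio n (y + 1))) / interpRatio n z (y + 1)) := by
      rw [← hy']
      field_simp
    rw [h3]
    unfold interpRatio
    ring
  rw [hws, hprod]
  exact mul_le_mul_of_nonneg_left (by linarith) hpos.le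

/-- The schedule of the interpolation parameter: a solution of the logistic equation started at
`1 / (1 + 1 / n)`, so that the supersolution is initially at least `1 / 2`. -/
noncomputable def schedule (n t : ℕ) : ℝ := 1 / (1 + (1 + relaxRate n) ^ t / n)

theorem schedule_pos {n : ℕ} (hn : 1 ≤ n) (t : ℕ) : 0 < schedule n t := by
  have := relaxRate_pos hn
  unfold schedule
  positivity

theorem schedule_lt_one {n : ℕ} (hn : 1 ≤ n) (t : ℕ) : schedule n t < 1 := by
  have := relaxRate_pos hn
  unfold schedule
  rw [div_lt_one (by positivity)]
  have : 0 < (1 + relaxRate n) ^ t / n := by positivity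
  linarith

/-- The schedule decreases, but no faster than the logistic equation allows. -/
theorem schedule_succ {n : ℕ} (hn : 1 ≤ n) (t : ℕ) :
    schedule n (t + 1) ≤ schedule n t ∧
      schedule n t - schedule n (t + 1) ≤ relaxRate n * (schedule n t * (1 - schedule n t)) := by
  have hδ := relaxRate_pos hn
  unfold schedule
  rw [pow_succ]
  set δ := relaxRate n
  have hy : 0 < (1 + δ) ^ t / n := by positivity
  rw [mul_div_right_comm]
  set y := (1 + δ) ^ t / n
  constructor
  · gcongr
    nlinarith
  · have e1 : 1 / (1 + y) - 1 / (1 + y * (1 + δ)) = δ * y / ((1 + y) * (1 + y * (1 + δ))) := by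
      have : 0 < 1 + y * (1 + δ) := by positivity
      field_simp
      ring
    have e2 : δ * (1 / (1 + y) * (1 - 1 / (1 + y))) = δ * y / ((1 + y) * (1 + y)) := by
      field_simp
      ring
    rw [e1, e2]
    gcongr
    nlinarith

theorem half_le_potential_zero {n x : ℕ} (hx : 2 * x ≤ n) (hn : 1 ≤ n) :
    1 / 2 ≤ potential n (schedule n 0) x := by
  have hnR : (1 : ℝ) ≤ n := by exact_mod_cast hn
  have h1 : schedule n 0 ^ x ≤ potential n (schedule n 0) x := by
    unfold potential
    calc schedule n 0 ^ x = ∏ _j ∈ Finset.range x, schedule n 0 := by simp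
      _ ≤ _ := by
        refine Finset.prod_le_prod (fun _ _ => (schedule_pos hn 0).le) fun j hj => ?_
        have := baseRatio_nonneg (n := n) (j := j + 1) (by simp at hj; omega)
        have h2 := mul_nonneg (by linarith [schedule_lt_one hn 0] : 0 ≤ 1 - schedule n 0) this
        unfold interpRatio
        linarith
  have h2 : schedule n 0 = 1 + -(1 / (n + 1)) := by
    unfold schedule
    field_simp
    ring
  have h3 : 1 + (x : ℝ) * -(1 / (n + 1)) ≤ schedule n 0 ^ x := by
    rw [h2]
    apply one_add_mul_le_pow
    have : 1 / ((n : ℝ) + 1) ≤ 1 := by rw [div_le_one (by positivity)]; linarith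
    linarith
  have h4 : (x : ℝ) * (1 / (n + 1)) ≤ 1 / 2 := by
    have : 2 * (x : ℝ) ≤ n := by exact_mod_cast hx
    rw [mul_one_div, div_le_div_iff₀ (by positivity) (by norm_num)]
    linarith
  linarith

/-- Comparison with the supersolution below a weight `r` at which the chain is already controlled;
the two boundary values of the comparison are the time `0` and the weight `r`. -/
theorem lowWeightProb_le_add_potential {n s r : ℕ} (hn : 3 ≤ n) (hr : 2 * r ≤ n) {B : ℝ}
    (hB0 : 0 ≤ B) (hB : ∀ t, lowWeightProb n s t r ≤ B) (t : ℕ) :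
    ∀ x, 1 ≤ x → x ≤ r → lowWeightProb n s t x ≤ B + 2 * potential n (schedule n t) x := by
  induction t with
  | zero =>
    intro x hx hxr
    have := half_le_potential_zero (n := n) (x := x) (by omega) (by omega)
    rw [lowWeightProb_zero]
    split_ifs <;> linarith
  | succ t ih =>
    intro x hx hxr
    rcases hxr.lt_or_eq with h | rfl
    · rw [lowWeightProb_succ_apply]
      obtain ⟨h1, h2⟩ := schedule_succ (n := n) (by omega) t
      have h3 := weightStep_potential_le (n := n) hx (by omega) (schedule_pos (by omega) t)
        (schedule_lt_one (by omega) t) (schedule_pos (by omega) (t + 1)) h1 h2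
      have h4 := weightStep_le_weightStep (n := n) (x := x) hn (by omega)
        (g := lowWeightProb n s t) (h := fun y => B + 2 * potential n (schedule n t) y)
        (ih x hx hxr) (fun _ => ih _ (by omega) (by omega)) (fun _ => ih _ (by omega) (by omega))
      rw [weightStep_add_mul] at h4
      linarith
    · have := potential_pos (n := n) (x := x) hr (schedule_pos (n := n) (by omega) (t + 1))
        (schedule_lt_one (by omega) (t + 1)).le
      linarith [hB (t + 1)]

/-- Once `z` is small, the number of strings of each weight times the supersolution is of order
`n * z`: the choice of `baseRatio` compensates the growth of `stringCount`. -/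
theorem stringCount_mul_potential_le {n : ℕ} (hn : 8 ≤ n) {z : ℝ} (hz0 : 0 < z)
    (hz : z * n ^ 2 ≤ 1) (x : ℕ) (hx : 2 * (x + 1) ≤ n) :
    stringCount n (x + 1) * potential n z (x + 1) ≤ 3 * n * z * (1 + 10 / n) ^ x := by
  have hnR : (8 : ℝ) ≤ n := by exact_mod_cast hn
  have hz1 : z ≤ 1 := by nlinarith
  induction x with
  | zero => simp [potential, interpRatio, baseRatio, stringCount]
  | succ x ih =>
    have ih' := ih (by omega)
    have hxR : 2 * ((x : ℝ) + 1 + 1) ≤ n := by exact_mod_cast hx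
    have hx0 : (0 : ℝ) ≤ x := Nat.cast_nonneg x
    have hcount : stringCount n (x + 1 + 1) =
        stringCount n (x + 1) * (3 * (n - ((x : ℝ) + 1)) / (x + 1 + 1)) := by
      have := stringCount_succ n (x + 1)
      push_cast at this
      rw [mul_div_assoc', eq_div_iff (by positivity)]
      linarith
    have hb : baseRatio n (x + 1 + 1) = ((x : ℝ) + 1 + 1) / (3 * (n - ((x : ℝ) + 1 + 1) - 1)) := by
      simp [baseRatio]
    have hfac : 3 * (n - ((x : ℝ) + 1)) / (x + 1 + 1) * interpRatio n z (x + 1 + 1) ≤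
        1 + 10 / n := by
      have hd : 0 < (n : ℝ) - ((x : ℝ) + 1 + 1) - 1 := by linarith
      have h1 : interpRatio n z (x + 1 + 1) ≤ z + baseRatio n (x + 1 + 1) := by
        have := baseRatio_nonneg hx
        unfold interpRatio
        nlinarith
      have h2 : 0 ≤ 3 * (n - ((x : ℝ) + 1)) / (x + 1 + 1) := by
        apply div_nonneg <;> linarith
      refine (mul_le_mul_of_nonneg_left h1 h2).trans ?_
      have e : 3 * (n - ((x : ℝ) + 1)) / (x + 1 + 1) * (z + baseRatio n (x + 1 + 1)) =
          3 * (n - ((x : ℝ) + 1)) / (x + 1 + 1) * z + 1 + 2 / (n - ((x : ℝ) + 1 + 1) - 1) := by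
        rw [hb]
        field_simp
        ring
      rw [e]
      have h3 : 3 * (n - ((x : ℝ) + 1)) / (x + 1 + 1) * z ≤ 2 / n := by
        have h4 : 3 * (n - ((x : ℝ) + 1)) / (x + 1 + 1) ≤ 3 * n / 2 := by
          apply div_le_div₀ <;> linarith
        have h5 : z ≤ 1 / n ^ 2 := by rw [le_div_iff₀ (by positivity)]; exact hz
        calc _ ≤ 3 * (n : ℝ) / 2 * (1 / n ^ 2) := by gcongr
          _ = (3 / 2) / n := by field_simp
          _ ≤ 2 / n := by gcongr; norm_num
      have h6 : 2 / (n - ((x : ℝ) + 1 + 1) - 1) ≤ 8 / n := by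
        rw [div_le_div_iff₀ hd (by linarith)]
        linarith
      have h7 : (2 : ℝ) / n + 8 / n = 10 / n := by ring
      linarith
    rw [potential_succ, hcount, pow_succ]
    have hp := potential_pos (n := n) (x := x + 1) (by omega) hz0 hz1
    have hi := interpRatio_pos (n := n) (j := x + 1 + 1) (by omega) hz0 hz1
    calc _ = (stringCount n (x + 1) * potential n z (x + 1)) *
          (3 * (n - ((x : ℝ) + 1)) / (x + 1 + 1) * interpRatio n z (x + 1 + 1)) := by ring
      _ ≤ (3 * n * z * (1 + 10 / n) ^ x) * (1 + 10 / n) := by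
        refine mul_le_mul ih' hfac (mul_nonneg ?_ hi.le) (by positivity)
        apply div_nonneg <;> linarith
      _ = _ := by ring

theorem stringCount_mul_potential_le_exp {n : ℕ} (hn : 8 ≤ n) {z : ℝ} (hz0 : 0 < z)
    (hz : z * n ^ 2 ≤ 1) (x : ℕ) (hx : 2 * (x + 1) ≤ n) :
    stringCount n (x + 1) * potential n z (x + 1) ≤ 3 * n * z * Real.exp 10 := by
  have hnR : (8 : ℝ) ≤ n := by exact_mod_cast hn
  refine (stringCount_mul_potential_le hn hz0 hz x hx).trans ?_
  gcongr
  calc (1 + 10 / (n : ℝ)) ^ x ≤ Real.exp (10 / n) ^ x := by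
        gcongr
        linarith [Real.add_one_le_exp (10 / (n : ℝ))]
    _ = Real.exp (x * (10 / n)) := (Real.exp_nat_mul _ _).symm
    _ ≤ _ := by
      rw [Real.exp_le_exp, mul_div_assoc', div_le_iff₀ (by linarith)]
      have : (x : ℝ) ≤ n := by exact_mod_cast (by omega : x ≤ n)
      linarith

/-- The constant `240` comes from `relaxRate n / 2 ≥ 1 / (240 n log n)` for `n ≥ 2`. -/
theorem schedule_mul_pow_le_one {n k t : ℕ} (hn : 2 ≤ n)
    (ht : 240 * (k + 3) * n * Real.log n ^ 2 < t) : schedule n t * n ^ (k + 2) ≤ 1 := by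
  have hnR : (2 : ℝ) ≤ n := by exact_mod_cast hn
  have hδ := relaxRate_pos (n := n) (by omega)
  have hδ1 := relaxRate_le_one (n := n) (by omega)
  have hlog : 1 / 2 ≤ Real.log n := by
    have := Real.log_le_log (by norm_num) hnR
    linarith [Real.log_two_gt_d9]
  have hexp : Real.exp (relaxRate n / 2) ≤ 1 + relaxRate n := by
    have h1 := Real.add_one_le_exp (-(relaxRate n / 2))
    rw [Real.exp_neg] at h1
    have h2 : 0 < Real.exp (relaxRate n / 2) := Real.exp_pos _
    have h3 : Real.exp (relaxRate n / 2) * (1 - relaxRate n / 2) ≤ 1 := by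
      have := mul_le_mul_of_nonneg_left h1 h2.le
      rw [mul_inv_cancel₀ h2.ne'] at this
      linarith
    by_contra hcon
    push Not at hcon
    have : (1 + relaxRate n) * (1 - relaxRate n / 2) <
        Real.exp (relaxRate n / 2) * (1 - relaxRate n / 2) :=
      mul_lt_mul_of_pos_right hcon (by linarith)
    nlinarith
  have hpow : (n : ℝ) ^ (k + 3) ≤ (1 + relaxRate n) ^ t := by
    calc (n : ℝ) ^ (k + 3) = Real.exp (Real.log n) ^ (k + 3) := by rw [Real.exp_log (by linarith)]
      _ = Real.exp ((k + 3 : ℕ) * Real.log n) := (Real.exp_nat_mul _ _).symm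
      _ ≤ Real.exp (t * (relaxRate n / 2)) := by
        rw [Real.exp_le_exp]
        have h1 : (240 * (k + 3) * n * Real.log n ^ 2) * (relaxRate n / 2) ≤
            t * (relaxRate n / 2) := by gcongr
        refine le_trans ?_ h1
        have h2 : relaxRate n / 2 = 1 / (80 * n * (1 + Real.log n)) := by
          unfold relaxRate
          field_simp
          norm_num
        rw [h2, mul_one_div, le_div_iff₀ (by positivity)]
        push_cast
        have h3 : 0 ≤ 80 * ((k : ℝ) + 3) * n * Real.log n := by positivity
        nlinarith [mul_le_mul_of_nonneg_left (by linarith : 1 + Real.log n ≤ 3 * Real.log n) h3]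
      _ = Real.exp (relaxRate n / 2) ^ t := Real.exp_nat_mul _ _
      _ ≤ _ := by gcongr
  have hle : schedule n t ≤ n / (1 + relaxRate n) ^ t := by
    unfold schedule
    rw [div_le_div_iff₀ (by positivity) (by positivity)]
    have : (n : ℝ) * (1 + (1 + relaxRate n) ^ t / n) = n + (1 + relaxRate n) ^ t := by field_simp
    rw [this]
    linarith
  calc schedule n t * n ^ (k + 2) ≤ n / (1 + relaxRate n) ^ t * n ^ (k + 2) := by gcongr
    _ = n ^ (k + 3) / (1 + relaxRate n) ^ t := by ring
    _ ≤ 1 := by rw [div_le_one (by positivity)]; exact hpow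

/-! ### Entropy bounds and the stationary contribution -/

/-- The entropy bound, from `n.choose m * f ^ m * (1 - f) ^ (n - m) ≤ 1`. -/
theorem stringCount_le_exp {f : ℝ} (hf0 : 0 < f) (hf : f < 1 / 2) {n m : ℕ} (hm : (m : ℝ) ≤ f * n)
    (hmn : m ≤ n) : stringCount n m ≤ Real.exp (n * (f * Real.log 3 + Real.binEntropy f)) := by
  have hbin : (n.choose m : ℝ) * (f ^ m * (1 - f) ^ (n - m)) ≤ 1 := by
    have h := add_pow f (1 - f) n
    rw [add_sub_cancel, one_pow] at h
    have := Finset.single_le_sum (f := fun m => f ^ m * (1 - f) ^ (n - m) * (n.choose m : ℝ))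
      (s := Finset.range (n + 1)) (fun i _ => by
        have : 0 ≤ 1 - f := by linarith
        positivity) (show m ∈ Finset.range (n + 1) by simp; omega)
    rw [← h] at this
    linarith
  have hlow : Real.exp (-(n * Real.binEntropy f)) ≤ f ^ m * (1 - f) ^ (n - m) := by
    have h1 : 0 < 1 - f := by linarith
    have e : f ^ m * (1 - f) ^ (n - m) =
        Real.exp (m * Real.log f + (n - m : ℕ) * Real.log (1 - f)) := by
      rw [Real.exp_add, Real.exp_nat_mul, Real.exp_nat_mul, Real.exp_log hf0, Real.exp_log h1]
    rw [e, Real.exp_le_exp, Real.binEntropy_eq_negMulLog_add_negMulLog_one_sub]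
    unfold Real.negMulLog
    rw [Nat.cast_sub hmn]
    have h2 : Real.log f ≤ Real.log (1 - f) := Real.log_le_log hf0 (by linarith)
    nlinarith
  have h3 : (3 : ℝ) ^ m ≤ Real.exp (n * (f * Real.log 3)) := by
    have : (3 : ℝ) ^ m = Real.exp (m * Real.log 3) := by
      rw [Real.exp_nat_mul, Real.exp_log (by norm_num)]
    rw [this, Real.exp_le_exp]
    have := mul_le_mul_of_nonneg_right hm (Real.log_nonneg (by norm_num : (1 : ℝ) ≤ 3))
    linarith
  have h4 : (n.choose m : ℝ) ≤ Real.exp (n * Real.binEntropy f) := by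
    have h5 : (n.choose m : ℝ) * Real.exp (-(n * Real.binEntropy f)) ≤ 1 :=
      (mul_le_mul_of_nonneg_left hlow (Nat.cast_nonneg _)).trans hbin
    rw [Real.exp_neg, ← div_eq_mul_inv, div_le_one (Real.exp_pos _)] at h5
    exact h5
  unfold stringCount
  rw [mul_add, Real.exp_add]
  gcongr

theorem stringCount_half_ge {n : ℕ} :
    (2 : ℝ) ^ n * Real.exp (n * (Real.log 3 / 2)) ≤ 3 * (n + 1) * stringCount n (n / 2) := by
  have h1 : (2 : ℝ) ^ n ≤ (n + 1) * n.choose (n / 2) := by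
    have h : 2 ^ n ≤ (n + 1) * n.choose (n / 2) := by
      rw [← Nat.sum_range_choose]
      refine (Finset.sum_le_sum fun m _ => Nat.choose_le_middle m n).trans ?_
      simp
    exact_mod_cast h
  have h2 : Real.exp (n * (Real.log 3 / 2)) ≤ 3 * 3 ^ (n / 2) := by
    have : (3 : ℝ) * 3 ^ (n / 2) = Real.exp ((n / 2 + 1 : ℕ) * Real.log 3) := by
      rw [Real.exp_nat_mul, Real.exp_log (by norm_num)]
      ring
    rw [this, Real.exp_le_exp]
    have h3 : (n : ℝ) ≤ 2 * (n / 2 + 1 : ℕ) := by exact_mod_cast (by omega : n ≤ 2 * (n / 2 + 1))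
    have := mul_le_mul_of_nonneg_right h3 (Real.log_nonneg (by norm_num : (1 : ℝ) ≤ 3))
    linarith
  unfold stringCount
  calc (2 : ℝ) ^ n * Real.exp (n * (Real.log 3 / 2)) ≤
      ((n + 1) * n.choose (n / 2)) * (3 * 3 ^ (n / 2)) := by gcongr
    _ = _ := by ring

theorem lt_half_of_entropy {f : ℝ} (hf0 : 0 ≤ f) (hf1 : f ≤ 1)
    (h : f * Real.log 3 + Real.binEntropy f - Real.log 3 / 2 < 0) : f < 1 / 2 := by
  have h1 := Real.binEntropy_nonneg hf0 hf1
  have h2 : 0 < Real.log 3 := Real.log_pos (by norm_num)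
  by_contra hcon
  push Not at hcon
  nlinarith

/-- The contribution of the stationary distribution, for any initial state. -/
theorem exists_stationary_bound (k : ℕ) {f : ℝ} (hf0 : 0 ≤ f) (hf1 : f ≤ 1)
    (hf : f * Real.log 3 + Real.binEntropy f - Real.log 3 / 2 < 0) :
    ∃ C : ℝ, 0 < C ∧ ∀ n s : ℕ, 1 ≤ n → (s : ℝ) ≤ f * n →
      2 ^ n * ((∑ m ∈ Finset.range s, stringCount n (m + 1)) / stringCount n (n / 2)) ≤
        C / (n : ℝ) ^ k := by
  set η := -(f * Real.log 3 + Real.binEntropy f - Real.log 3 / 2) with hη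
  have hη0 : 0 < η := by linarith
  refine ⟨6 * ((k + 2).factorial / η ^ (k + 2)), by positivity, fun n s hn hs => ?_⟩
  have hnR : (1 : ℝ) ≤ n := by exact_mod_cast hn
  have hhalf := lt_half_of_entropy hf0 hf1 hf
  have hsn : s ≤ n := by
    have : (s : ℝ) ≤ n := hs.trans (by nlinarith)
    exact_mod_cast this
  have hS : ∑ m ∈ Finset.range s, stringCount n (m + 1) ≤
      n * Real.exp (n * (f * Real.log 3 + Real.binEntropy f)) := by
    calc _ ≤ ∑ m ∈ Finset.range s, Real.exp (n * (f * Real.log 3 + Real.binEntropy f)) := by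
          refine Finset.sum_le_sum fun m hm => ?_
          have hms := Finset.mem_range.mp hm
          have hmf : ((m + 1 : ℕ) : ℝ) ≤ f * n :=
            le_trans (by exact_mod_cast hms) hs
          -- a positive `m + 1 ≤ f * n` rules out `f = 0`, where the entropy bound is not available
          have hfpos : 0 < f := by
            have : (0 : ℝ) < (m + 1 : ℕ) := by positivity
            by_contra hcon
            push Not at hcon
            nlinarith
          exact stringCount_le_exp hfpos hhalf hmf (by omega)
      _ = s * Real.exp (n * (f * Real.log 3 + Real.binEntropy f)) := by simp
      _ ≤ _ := by gcongr
  have hN := stringCount_pos (Nat.div_le_self n 2)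
  rw [mul_div_assoc', div_le_iff₀ hN]
  have hpow : (n : ℝ) ^ (k + 2) ≤ (k + 2).factorial / η ^ (k + 2) * Real.exp (n * η) := by
    have h := Real.pow_div_factorial_le_exp (n * η) (by positivity) (k + 2)
    rw [div_le_iff₀ (by positivity), mul_pow] at h
    rw [div_mul_eq_mul_div, le_div_iff₀ (by positivity)]
    linarith
  have hsplit : Real.exp (n * (f * Real.log 3 + Real.binEntropy f)) * Real.exp (n * η) =
      Real.exp (n * (Real.log 3 / 2)) := by
    rw [← Real.exp_add]
    congr 1
    rw [hη]
    ring
  have hhalfge := stringCount_half_ge (n := n)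
  set E := Real.exp (n * (f * Real.log 3 + Real.binEntropy f)) with hE
  set K := ((k + 2).factorial : ℝ) / η ^ (k + 2) with hK
  have hEpos : 0 < E := Real.exp_pos _
  have hKpos : 0 < K := by positivity
  rw [div_mul_eq_mul_div, le_div_iff₀ (by positivity)]
  have hn0 : (0 : ℝ) < n := by linarith
  -- `n * 2 ^ n * E * n ^ k ≤ K * 2 ^ n * exp (n log 3 / 2) / n`, and `3 * (n + 1) / n ≤ 6`
  have h1 : (n : ℝ) * (2 ^ n * (n * E) * n ^ k) ≤ K * (3 * (n + 1) * stringCount n (n / 2)) := by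
    calc (n : ℝ) * (2 ^ n * (n * E) * n ^ k) = 2 ^ n * E * n ^ (k + 2) := by ring
      _ ≤ 2 ^ n * E * (K * Real.exp (n * η)) := by gcongr
      _ = K * (2 ^ n * (E * Real.exp (n * η))) := by ring
      _ = K * (2 ^ n * Real.exp (n * (Real.log 3 / 2))) := by rw [hsplit]
      _ ≤ _ := by gcongr
  have h2 : K * (3 * (n + 1) * stringCount n (n / 2)) ≤ n * (6 * K * stringCount n (n / 2)) := by
    have : 0 < K * stringCount n (n / 2) := by positivity
    nlinarith
  have h3 : 2 ^ n * (n * E) * (n : ℝ) ^ k ≤ 6 * K * stringCount n (n / 2) :=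
    le_of_mul_le_mul_left (h1.trans h2) hn0
  refine le_trans ?_ h3
  gcongr

/-- The bound on the weighted low-weight probabilities, `w x` being the total squared Pauli
coefficient of the initial state on strings of weight `x`. -/
theorem exists_sum_lowWeightProb_le (k : ℕ) {f : ℝ} (hf0 : 0 ≤ f) (hf1 : f ≤ 1)
    (hf : f * Real.log 3 + Real.binEntropy f - Real.log 3 / 2 < 0) :
    ∃ C : ℝ, 0 < C ∧ ∀ n s t : ℕ, 8 ≤ n → (s : ℝ) ≤ f * n →
      240 * (k + 3) * n * Real.log n ^ 2 < t →
      ∀ w : ℕ → ℝ, (∀ x, 0 ≤ w x) → (∀ x, w x ≤ stringCount n x) →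
      ∑ x ∈ Finset.range n, w (x + 1) ≤ 2 ^ n →
      ∑ x ∈ Finset.range n, w (x + 1) * lowWeightProb n s t (x + 1) ≤ C / (n : ℝ) ^ k := by
  obtain ⟨C, hC, hCn⟩ := exists_stationary_bound k hf0 hf1 hf
  refine ⟨C + 6 * Real.exp 10, by positivity, fun n s t hn hs ht w hw0 hw1 hw => ?_⟩
  have hnR : (8 : ℝ) ≤ n := by exact_mod_cast hn
  have hsn : s ≤ n := by
    have h : (s : ℝ) ≤ n := hs.trans (by nlinarith)
    exact_mod_cast h
  set r := n / 2 with hr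
  have hN := stringCount_pos (Nat.div_le_self n 2)
  set B := (∑ m ∈ Finset.range s, stringCount n (m + 1)) / stringCount n r with hBdef
  have hB0 : 0 ≤ B := div_nonneg (Finset.sum_nonneg fun m _ => stringCount_nonneg _ _) hN.le
  have hB : ∀ t, lowWeightProb n s t r ≤ B := fun t =>
    lowWeightProb_le_sum_div (by omega) t (by omega) (by omega) hsn
  set z := schedule n t
  have hz0 : 0 < z := schedule_pos (by omega) t
  have hzk : z * n ^ (k + 2) ≤ 1 := schedule_mul_pow_le_one (by omega) ht
  have hz2 : z * n ^ 2 ≤ 1 := by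
    refine le_trans ?_ hzk
    gcongr
    · linarith
    · omega
  have hterm : ∀ x < n, w (x + 1) * lowWeightProb n s t (x + 1) ≤
      w (x + 1) * B + 2 * (3 * n * z * Real.exp 10) := by
    intro x hx
    rcases le_or_gt (x + 1) r with h | h
    · have h1 := lowWeightProb_le_add_potential (n := n) (by omega) (by omega) hB0 hB t (x + 1)
        (by omega) h
      have h2 := mul_le_mul_of_nonneg_left h1 (hw0 (x + 1))
      have h3 := stringCount_mul_potential_le_exp hn hz0 hz2 x (by omega)
      have h4 := mul_le_mul_of_nonneg_right (hw1 (x + 1)) (potential_pos (n := n) (x := x + 1)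
        (by omega) hz0 (schedule_lt_one (by omega) t).le).le
      linarith
    · have h1 := (lowWeightProb_le_of_le (n := n) (s := s) (by omega) t h.le
        (by omega)).trans (hB t)
      have h2 := mul_le_mul_of_nonneg_left h1 (hw0 (x + 1))
      have h3 : 0 ≤ 2 * (3 * n * z * Real.exp 10) := by positivity
      linarith
  have h1 : ∑ x ∈ Finset.range n, w (x + 1) * lowWeightProb n s t (x + 1) ≤
      (∑ x ∈ Finset.range n, w (x + 1)) * B + n * (2 * (3 * n * z * Real.exp 10)) := by
    refine (Finset.sum_le_sum fun x hx => hterm x (Finset.mem_range.mp hx)).trans_eq ?_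
    rw [Finset.sum_add_distrib, ← Finset.sum_mul]
    simp
  have h2 : (∑ x ∈ Finset.range n, w (x + 1)) * B ≤ C / (n : ℝ) ^ k :=
    (mul_le_mul_of_nonneg_right hw hB0).trans (hCn n s (by omega) hs)
  have h3 : n * (2 * (3 * n * z * Real.exp 10)) ≤ 6 * Real.exp 10 / (n : ℝ) ^ k := by
    rw [le_div_iff₀ (by positivity)]
    calc _ = 6 * Real.exp 10 * (z * n ^ (k + 2)) := by ring
      _ ≤ 6 * Real.exp 10 * 1 := by gcongr
      _ = _ := mul_one _
  rw [add_div]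
  linarith

/-! ### Pauli strings and their coefficients -/

/-- Parseval's identity for a family of matrices satisfying a completeness relation. -/
theorem sum_norm_sq_trace_mul {κ d : Type*} [Fintype κ] [Fintype d] [DecidableEq d]
    (P : κ → Matrix d d ℂ) (D : ℝ)
    (hP : ∀ x y x' y', ∑ a, P a x y * star (P a x' y') = if x = x' ∧ y = y' then (D : ℂ) else 0)
    (X : Matrix d d ℂ) :
    ∑ a, ‖(P a * X).trace‖ ^ 2 = D * ∑ x, ∑ y, ‖X x y‖ ^ 2 := by
  have htr : ∀ a, (P a * X).trace = ∑ q : d × d, P a q.1 q.2 * X q.2 q.1 := by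
    intro a
    simp [Matrix.trace, Matrix.mul_apply, Fintype.sum_prod_type]
  have key : ((∑ a, ‖(P a * X).trace‖ ^ 2 : ℝ) : ℂ) = ((D * ∑ x, ∑ y, ‖X x y‖ ^ 2 : ℝ) : ℂ) := by
    push_cast
    have hn : ∀ w : ℂ, ((‖w‖ : ℂ)) ^ 2 = w * star w := fun w => (Complex.mul_conj' w).symm
    simp_rw [hn, htr, star_sum, Finset.sum_mul_sum]
    rw [Finset.sum_comm]
    have h1 : ∀ q : d × d, ∑ a, ∑ q' : d × d, P a q.1 q.2 * X q.2 q.1 *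
        star (P a q'.1 q'.2 * X q'.2 q'.1) = D * (X q.2 q.1 * star (X q.2 q.1)) := by
      intro q
      rw [Finset.sum_comm]
      have h2 : ∀ q' : d × d, ∑ a, P a q.1 q.2 * X q.2 q.1 * star (P a q'.1 q'.2 * X q'.2 q'.1) =
          if q = q' then D * (X q.2 q.1 * star (X q.2 q.1)) else 0 := by
        intro q'
        have h3 : ∀ a, P a q.1 q.2 * X q.2 q.1 * star (P a q'.1 q'.2 * X q'.2 q'.1) =
            (P a q.1 q.2 * star (P a q'.1 q'.2)) * (X q.2 q.1 * star (X q'.2 q'.1)) := by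
          intro a
          rw [star_mul']
          ring
        simp_rw [h3]
        rw [← Finset.sum_mul, hP]
        by_cases h : q = q'
        · subst h; simp
        · rw [if_neg, if_neg h, zero_mul]
          exact fun h' => h (Prod.ext h'.1 h'.2)
      simp_rw [h2]
      simp
    simp_rw [h1]
    rw [Fintype.sum_prod_type, Finset.sum_comm, Finset.mul_sum]
    simp_rw [Finset.mul_sum]
  exact_mod_cast key

theorem pauli_completeness (x y x' y' : Fin 2) :
    ∑ a, pauli a x y * star (pauli a x' y') = if x = x' ∧ y = y' then 2 else 0 := by
  fin_cases x <;> fin_cases y <;> fin_cases x' <;> fin_cases y' <;>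
    simp [pauli, Fin.sum_univ_four] <;> norm_num

theorem pauli_isHermitian (a : Fin 4) : (pauli a)ᴴ = pauli a := by
  ext x y
  fin_cases a <;> fin_cases x <;> fin_cases y <;> simp [pauli]

/-- The index of the product of two Pauli matrices, up to a phase. -/
def pauliMul : Fin 4 → Fin 4 → Fin 4 := ![![0, 1, 2, 3], ![1, 0, 3, 2], ![2, 3, 0, 1], ![3, 2, 1, 0]]

/-- The phase in the product of two Pauli matrices, as an exponent of `I`. -/
def pauliPhase : Fin 4 → Fin 4 → ℕ :=
  ![![0, 0, 0, 0], ![0, 0, 1, 3], ![0, 3, 0, 1], ![0, 1, 3, 0]]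

theorem pauli_mul (a b : Fin 4) :
    pauli a * pauli b = Complex.I ^ pauliPhase a b • pauli (pauliMul a b) := by
  have h3 : Complex.I ^ 3 = -Complex.I := Complex.I_pow_three
  ext x y
  fin_cases a <;> fin_cases b <;> fin_cases x <;> fin_cases y <;>
    simp [pauli, pauliPhase, pauliMul, Matrix.mul_apply, Fin.sum_univ_two, h3]

/-- The two-qubit Pauli operators. -/
noncomputable def pauliPair (p : Fin 4 × Fin 4) : Matrix (Fin 2 × Fin 2) (Fin 2 × Fin 2) ℂ :=
  pauli p.1 ⊗ₖ pauli p.2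

/-- The index of the product of two two-qubit Pauli operators, up to a phase. -/
def pauliPairMul (p q : Fin 4 × Fin 4) : Fin 4 × Fin 4 := (pauliMul p.1 q.1, pauliMul p.2 q.2)

/-- The phase in the product of two two-qubit Pauli operators, as an exponent of `I`. -/
def pauliPairPhase (p q : Fin 4 × Fin 4) : ℕ := pauliPhase p.1 q.1 + pauliPhase p.2 q.2

theorem pauliPair_mul (p q : Fin 4 × Fin 4) :
    pauliPair p * pauliPair q = Complex.I ^ pauliPairPhase p q • pauliPair (pauliPairMul p q) := by
  unfold pauliPair pauliPairPhase pauliPairMul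
  rw [← Matrix.mul_kronecker_mul, pauli_mul, pauli_mul, Matrix.smul_kronecker,
    Matrix.kronecker_smul, smul_smul, pow_add]

theorem pauliPair_zero : pauliPair 0 = 1 := by
  simp [pauliPair, pauli]

theorem pauliPair_isHermitian (p : Fin 4 × Fin 4) : (pauliPair p)ᴴ = pauliPair p := by
  unfold pauliPair
  rw [Matrix.conjTranspose_kronecker, pauli_isHermitian, pauli_isHermitian]

theorem pauliPair_mul_self (p : Fin 4 × Fin 4) : pauliPair p * pauliPair p = 1 := by
  rw [pauliPair_mul, ← pauliPair_zero]
  have h1 : ∀ p : Fin 4 × Fin 4, pauliPairPhase p p = 0 := by decide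
  have h2 : ∀ p : Fin 4 × Fin 4, pauliPairMul p p = 0 := by decide
  rw [h1, h2, pow_zero, one_smul]

theorem pauliPair_mem_signedPauli (p : Fin 4 × Fin 4) : pauliPair p ∈ signedPauli :=
  ⟨p.1, p.2, Or.inl rfl⟩

theorem neg_mem_signedPauli {P : Matrix (Fin 2 × Fin 2) (Fin 2 × Fin 2) ℂ} (h : P ∈ signedPauli) :
    -P ∈ signedPauli := by
  obtain ⟨a, b, h | h⟩ := h
  · exact ⟨a, b, Or.inr (by rw [h])⟩
  · exact ⟨a, b, Or.inl (by rw [h, neg_neg])⟩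

theorem exists_of_mem_signedPauli {P : Matrix (Fin 2 × Fin 2) (Fin 2 × Fin 2) ℂ}
    (h : P ∈ signedPauli) : ∃ q, P = pauliPair q ∨ P = -pauliPair q := by
  obtain ⟨a, b, h⟩ := h
  exact ⟨(a, b), h⟩

/-- An even phase exponent means that the two Pauli operators commute. -/
theorem pauliPair_mul_comm_of_even {p q : Fin 4 × Fin 4} (h : pauliPairPhase p q % 2 = 0) :
    pauliPair p * pauliPair q = pauliPair q * pauliPair p := by
  have h1 : ∀ p q : Fin 4 × Fin 4, pauliPairPhase p q % 2 = 0 →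
      pauliPairPhase p q % 4 = pauliPairPhase q p % 4 := by decide
  have h2 : ∀ p q : Fin 4 × Fin 4, pauliPairMul p q = pauliPairMul q p := by decide
  rw [pauliPair_mul, pauliPair_mul, h2 p q, Complex.I_pow_eq_pow_mod, h1 p q h,
    ← Complex.I_pow_eq_pow_mod]

/-- An odd phase exponent means that the two Pauli operators anticommute. -/
theorem pauliPair_mul_anticomm_of_odd {p q : Fin 4 × Fin 4} (h : pauliPairPhase p q % 2 = 1) :
    pauliPair p * pauliPair q = -(pauliPair q * pauliPair p) := by
  have h1 : ∀ p q : Fin 4 × Fin 4, pauliPairPhase p q % 2 = 1 →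
      pauliPairPhase p q % 4 = (2 + pauliPairPhase q p) % 4 := by decide
  have h2 : ∀ p q : Fin 4 × Fin 4, pauliPairMul p q = pauliPairMul q p := by decide
  rw [pauliPair_mul, pauliPair_mul, h2 p q, Complex.I_pow_eq_pow_mod, h1 p q h,
    ← Complex.I_pow_eq_pow_mod, pow_add, Complex.I_sq, ← neg_smul]
  simp

theorem I_smul_pauliPair_mul_of_odd {p q : Fin 4 × Fin 4} (h : pauliPairPhase p q % 2 = 1) :
    Complex.I • (pauliPair p * pauliPair q) = pauliPair (pauliPairMul p q) ∨
      Complex.I • (pauliPair p * pauliPair q) = -pauliPair (pauliPairMul p q) := by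
  rw [pauliPair_mul, smul_smul, ← pow_succ', Complex.I_pow_eq_pow_mod]
  have h1 : (pauliPairPhase p q + 1) % 4 = 0 ∨ (pauliPairPhase p q + 1) % 4 = 2 := by omega
  rcases h1 with h1 | h1
  · left; rw [h1]; simp
  · right; rw [h1]; simp

/-- The rotation `(1 + i σ_p) / √2` as a matrix. -/
noncomputable def pauliRotationMatrix (p : Fin 4 × Fin 4) :
    Matrix (Fin 2 × Fin 2) (Fin 2 × Fin 2) ℂ :=
  ((1 / Real.sqrt 2 : ℝ) : ℂ) • (1 + Complex.I • pauliPair p)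

theorem star_pauliRotationMatrix (p : Fin 4 × Fin 4) :
    star (pauliRotationMatrix p) =
      ((1 / Real.sqrt 2 : ℝ) : ℂ) • (1 - Complex.I • pauliPair p) := by
  unfold pauliRotationMatrix
  rw [Matrix.star_eq_conjTranspose, Matrix.conjTranspose_smul, Matrix.conjTranspose_add,
    Matrix.conjTranspose_one, Matrix.conjTranspose_smul, pauliPair_isHermitian]
  simp [sub_eq_add_neg]

theorem inv_sqrt_two_mul_self :
    ((1 / Real.sqrt 2 : ℝ) : ℂ) * ((1 / Real.sqrt 2 : ℝ) : ℂ) = 1 / 2 := by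
  rw [← Complex.ofReal_mul, div_mul_div_comm, Real.mul_self_sqrt (by norm_num)]
  norm_num

theorem rotation_conj_of_commute {P R : Matrix (Fin 2 × Fin 2) (Fin 2 × Fin 2) ℂ} (hP : P * P = 1)
    (h : P * R = R * P) (c : ℂ) (hc : c * c = 1 / 2) (u : ℂ) (hu : u * u = -1) :
    (c • (1 + u • P)) * R * (c • (1 - u • P)) = R := by
  have e : (1 + u • P) * R * (1 - u • P) = (2 : ℂ) • R := by
    have h1 : P * R * P = R := by rw [h, mul_assoc, hP, mul_one]
    simp only [add_mul, mul_sub, one_mul, mul_one, smul_mul_assoc, mul_smul_comm, h1]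
    rw [h]
    match_scalars <;> first | ring1 | linear_combination (-1 : ℂ) * hu
  rw [smul_mul_assoc, smul_mul_assoc, mul_smul_comm, smul_smul, e, hc, smul_smul]
  norm_num

theorem rotation_conj_of_anticommute {P R : Matrix (Fin 2 × Fin 2) (Fin 2 × Fin 2) ℂ}
    (hP : P * P = 1) (h : P * R = -(R * P)) (c : ℂ) (hc : c * c = 1 / 2) (u : ℂ)
    (hu : u * u = -1) :
    (c • (1 + u • P)) * R * (c • (1 - u • P)) = u • (P * R) := by
  have e : (1 + u • P) * R * (1 - u • P) = (2 : ℂ) • u • (P * R) := by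
    have h1 : P * R * P = -R := by rw [h, neg_mul, mul_assoc, hP, mul_one]
    have h2 : R * P = -(P * R) := by rw [h, neg_neg]
    simp only [add_mul, mul_sub, one_mul, mul_one, smul_mul_assoc, mul_smul_comm, h1, smul_smul]
    rw [h2]
    match_scalars <;> first | ring1 | linear_combination hu
  rw [smul_mul_assoc, smul_mul_assoc, mul_smul_comm, smul_smul, e, hc, smul_smul]
  norm_num

/-- The rotation `(1 + i σ_p) / √2` as a unitary. -/
noncomputable def pauliRotation (p : Fin 4 × Fin 4) : TwoQubitUnitary :=
  ⟨pauliRotationMatrix p, by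
    rw [Matrix.mem_unitaryGroup_iff, star_pauliRotationMatrix]
    have := rotation_conj_of_commute (pauliPair_mul_self p) (R := 1) (by simp)
      _ inv_sqrt_two_mul_self Complex.I Complex.I_mul_I
    rwa [mul_one] at this⟩

theorem pauliRotation_conj_of_even {p q : Fin 4 × Fin 4} (h : pauliPairPhase p q % 2 = 0) :
    (pauliRotation p).1 * pauliPair q * star (pauliRotation p).1 = pauliPair q ∧
      star (pauliRotation p).1 * pauliPair q * (pauliRotation p).1 = pauliPair q := by
  change pauliRotationMatrix p * _ * star (pauliRotationMatrix p) = _ ∧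
    star (pauliRotationMatrix p) * _ * pauliRotationMatrix p = _
  rw [star_pauliRotationMatrix]
  unfold pauliRotationMatrix
  refine ⟨rotation_conj_of_commute (pauliPair_mul_self p) (pauliPair_mul_comm_of_even h) _
    inv_sqrt_two_mul_self _ Complex.I_mul_I, ?_⟩
  have := rotation_conj_of_commute (pauliPair_mul_self p) (pauliPair_mul_comm_of_even h) _
    inv_sqrt_two_mul_self (-Complex.I) (by simp)
  simpa [sub_eq_add_neg] using this

theorem pauliRotation_conj_of_odd {p q : Fin 4 × Fin 4} (h : pauliPairPhase p q % 2 = 1) :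
    (pauliRotation p).1 * pauliPair q * star (pauliRotation p).1 =
        Complex.I • (pauliPair p * pauliPair q) ∧
      star (pauliRotation p).1 * pauliPair q * (pauliRotation p).1 =
        -(Complex.I • (pauliPair p * pauliPair q)) := by
  change pauliRotationMatrix p * _ * star (pauliRotationMatrix p) = _ ∧
    star (pauliRotationMatrix p) * _ * pauliRotationMatrix p = _
  rw [star_pauliRotationMatrix]
  unfold pauliRotationMatrix
  refine ⟨rotation_conj_of_anticommute (pauliPair_mul_self p) (pauliPair_mul_anticomm_of_odd h) _
    inv_sqrt_two_mul_self _ Complex.I_mul_I, ?_⟩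
  have := rotation_conj_of_anticommute (pauliPair_mul_self p) (pauliPair_mul_anticomm_of_odd h) _
    inv_sqrt_two_mul_self (-Complex.I) (by simp)
  simpa [sub_eq_add_neg] using this

theorem pauliRotation_mem (p : Fin 4 × Fin 4) : pauliRotation p ∈ cliffordGroup := by
  have key : ∀ q, (pauliRotation p).1 * pauliPair q * star (pauliRotation p).1 ∈ signedPauli ∧
      star (pauliRotation p).1 * pauliPair q * (pauliRotation p).1 ∈ signedPauli := by
    intro q
    rcases Nat.mod_two_eq_zero_or_one (pauliPairPhase p q) with h | h
    · obtain ⟨h1, h2⟩ := pauliRotation_conj_of_even h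
      rw [h1, h2]
      exact ⟨pauliPair_mem_signedPauli q, pauliPair_mem_signedPauli q⟩
    · obtain ⟨h1, h2⟩ := pauliRotation_conj_of_odd h
      have h3 : Complex.I • (pauliPair p * pauliPair q) ∈ signedPauli := by
        rcases I_smul_pauliPair_mul_of_odd h with h4 | h4 <;> rw [h4]
        · exact pauliPair_mem_signedPauli _
        · exact neg_mem_signedPauli (pauliPair_mem_signedPauli _)
      rw [h1, h2]
      exact ⟨h3, neg_mem_signedPauli h3⟩
  intro P hP
  obtain ⟨q, rfl | rfl⟩ := exists_of_mem_signedPauli hP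
  · exact key q
  · rw [mul_neg, neg_mul, mul_neg, neg_mul]
    exact ⟨neg_mem_signedPauli (key q).1, neg_mem_signedPauli (key q).2⟩

/-- The rotation about `σ_p σ_m` maps `σ_p` to `± σ_m` if the two anticommute. -/
theorem exists_clifford_conj_of_odd {p m : Fin 4 × Fin 4} (h : pauliPairPhase p m % 2 = 1) :
    ∃ V ∈ cliffordGroup, star V.1 * pauliPair p * V.1 = pauliPair m ∨
      star V.1 * pauliPair p * V.1 = -pauliPair m := by
  refine ⟨pauliRotation (pauliPairMul p m), pauliRotation_mem _, ?_⟩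
  have h1 : ∀ p m : Fin 4 × Fin 4, pauliPairPhase p m % 2 = 1 →
      pauliPairPhase (pauliPairMul p m) p % 2 = 1 := by decide
  have h2 : ∀ p m : Fin 4 × Fin 4, pauliPairMul (pauliPairMul p m) p = m := by decide
  rw [(pauliRotation_conj_of_odd (h1 p m h)).2]
  have h3 := I_smul_pauliPair_mul_of_odd (h1 p m h)
  rw [h2] at h3
  rcases h3 with h3 | h3
  · right; rw [h3]
  · left; rw [h3, neg_neg]

/-- Two nontrivial two-qubit Pauli operators have a common anticommuting Pauli operator. -/
theorem exists_common_anticommuting {p q : Fin 4 × Fin 4} (hp : p ≠ 0) (hq : q ≠ 0) :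
    ∃ m, pauliPairPhase p m % 2 = 1 ∧ pauliPairPhase m q % 2 = 1 := by
  revert p q
  decide

/-- The Clifford group acts transitively on the nontrivial Pauli operators, up to sign. -/
theorem exists_clifford_conj {p q : Fin 4 × Fin 4} (hp : p ≠ 0) (hq : q ≠ 0) :
    ∃ V ∈ cliffordGroup, star V.1 * pauliPair p * V.1 = pauliPair q ∨
      star V.1 * pauliPair p * V.1 = -pauliPair q := by
  obtain ⟨m, h1, h2⟩ := exists_common_anticommuting hp hq
  obtain ⟨V, hV, hVp⟩ := exists_clifford_conj_of_odd h1
  obtain ⟨W, hW, hWm⟩ := exists_clifford_conj_of_odd h2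
  refine ⟨V * W, cliffordGroup.mul_mem hV hW, ?_⟩
  have e : star (V * W).1 * pauliPair p * (V * W).1 =
      star W.1 * (star V.1 * pauliPair p * V.1) * W.1 := by
    simp [mul_assoc]
  rw [e]
  rcases hVp with h | h <;> rcases hWm with h' | h' <;> simp [h, h']

theorem pauliPair_completeness (x y x' y' : Fin 2 × Fin 2) :
    ∑ p, pauliPair p x y * star (pauliPair p x' y') =
      if x = x' ∧ y = y' then ((4 : ℝ) : ℂ) else 0 := by
  have h : ∀ a b : Fin 4, pauliPair (a, b) x y * star (pauliPair (a, b) x' y') =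
      (pauli a x.1 y.1 * star (pauli a x'.1 y'.1)) * (pauli b x.2 y.2 * star (pauli b x'.2 y'.2)) := by
    intro a b
    simp only [pauliPair, Matrix.kroneckerMap_apply, star_mul']
    ring
  rw [Fintype.sum_prod_type]
  simp_rw [h]
  rw [← Finset.sum_mul_sum, pauli_completeness, pauli_completeness, ite_zero_mul_ite_zero]
  have hiff : ((x.1 = x'.1 ∧ y.1 = y'.1) ∧ x.2 = x'.2 ∧ y.2 = y'.2) ↔ (x = x' ∧ y = y') := by
    simp only [Prod.ext_iff]
    tauto
  simp only [hiff]
  norm_num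

theorem sum_norm_sq_eq_trace {d : Type*} [Fintype d] (X : Matrix d d ℂ) :
    ∑ x, ∑ y, ‖X x y‖ ^ 2 = (Xᴴ * X).trace.re := by
  rw [Finset.sum_comm]
  simp only [Matrix.trace, Matrix.diag_apply, Matrix.mul_apply, Matrix.conjTranspose_apply,
    Complex.re_sum]
  refine Finset.sum_congr rfl fun y _ => Finset.sum_congr rfl fun x _ => ?_
  rw [mul_comm, RCLike.star_def, Complex.mul_conj']
  norm_cast

theorem sum_norm_sq_unitary_conj {d : Type*} [Fintype d] [DecidableEq d]
    {U : Matrix d d ℂ} (hU : star U * U = 1) (X : Matrix d d ℂ) :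
    ∑ x, ∑ y, ‖(U * X * star U) x y‖ ^ 2 = ∑ x, ∑ y, ‖X x y‖ ^ 2 := by
  rw [sum_norm_sq_eq_trace, sum_norm_sq_eq_trace]
  have e : (U * X * star U)ᴴ * (U * X * star U) = U * (Xᴴ * X) * star U := by
    rw [Matrix.conjTranspose_mul, Matrix.conjTranspose_mul, ← Matrix.star_eq_conjTranspose (star U),
      star_star, ← Matrix.star_eq_conjTranspose U]
    calc U * (Xᴴ * star U) * (U * X * star U) = U * Xᴴ * (star U * U) * X * star U := by
          simp only [mul_assoc]
      _ = _ := by rw [hU, mul_one, mul_assoc U]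
  rw [e, Matrix.trace_mul_comm, ← mul_assoc, hU, one_mul]

/-! ### The second moment of a random two-qubit gate -/

/-- A law of random two-qubit gates that is invariant under left multiplication by Clifford gates;
this is the only property of the two gate distributions that matters. -/
structure IsCliffordInvariant (μ : Measure TwoQubitUnitary) : Prop where
  isProbabilityMeasure : IsProbabilityMeasure μ
  map_mul_left : ∀ V ∈ cliffordGroup, μ.map (fun U => V * U) = μ

theorem isProbabilityMeasure_compactHaar (G : Type*) [Group G] [TopologicalSpace G]
    [IsTopologicalGroup G] [CompactSpace G] [MeasurableSpace G] [BorelSpace G] :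
    IsProbabilityMeasure (compactHaar G) :=
  ⟨by
    have h := Measure.haarMeasure_self (K₀ := (⊤ : TopologicalSpace.PositiveCompacts G))
    simpa [compactHaar] using h⟩

theorem isCliffordInvariant_haarGate : IsCliffordInvariant haarGate where
  isProbabilityMeasure := isProbabilityMeasure_compactHaar _
  map_mul_left V _ := by
    unfold haarGate compactHaar
    exact map_mul_left_eq_self _ V

theorem isCliffordInvariant_cliffordGate : IsCliffordInvariant cliffordGate where
  isProbabilityMeasure := by
    have := isProbabilityMeasure_compactHaar cliffordGroup
    exact Measure.isProbabilityMeasure_map measurable_subtype_coe.aemeasurable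
  map_mul_left V hV := by
    unfold cliffordGate
    rw [Measure.map_map (continuous_const_mul V).measurable measurable_subtype_coe]
    have h : Measure.map (fun W : cliffordGroup => (⟨V, hV⟩ : cliffordGroup) * W)
        (compactHaar cliffordGroup) = compactHaar cliffordGroup := by
      unfold compactHaar
      exact map_mul_left_eq_self _ _
    conv_rhs => rw [← h]
    rw [Measure.map_map measurable_subtype_coe (continuous_const_mul _).measurable]
    rfl

theorem continuous_norm_sq_trace_conj (P Y : Matrix (Fin 2 × Fin 2) (Fin 2 × Fin 2) ℂ) :
    Continuous fun U : TwoQubitUnitary => ‖(P * (U.1 * Y * star U.1)).trace‖ ^ 2 := by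
  have h : Continuous fun U : TwoQubitUnitary => P * (U.1 * Y * star U.1) := by fun_prop
  exact (h.matrix_trace.norm).pow 2

theorem integrable_of_continuous_of_compactSpace {X : Type*} [TopologicalSpace X] [CompactSpace X]
    [MeasurableSpace X] [OpensMeasurableSpace X] {μ : Measure X} [IsFiniteMeasure μ] {f : X → ℝ}
    (hf : Continuous f) : Integrable f μ :=
  hf.integrable_of_hasCompactSupport (HasCompactSupport.of_compactSpace f)

/-- Second moments of all nontrivial Pauli coefficients agree, by Clifford transitivity. -/
theorem IsCliffordInvariant.integral_eq {μ : Measure TwoQubitUnitary} (hμ : IsCliffordInvariant μ)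
    {p q : Fin 4 × Fin 4} (hp : p ≠ 0) (hq : q ≠ 0)
    (Y : Matrix (Fin 2 × Fin 2) (Fin 2 × Fin 2) ℂ) :
    ∫ U, ‖(pauliPair p * (U.1 * Y * star U.1)).trace‖ ^ 2 ∂μ =
      ∫ U, ‖(pauliPair q * (U.1 * Y * star U.1)).trace‖ ^ 2 ∂μ := by
  obtain ⟨V, hV, h⟩ := exists_clifford_conj hp hq
  conv_lhs => rw [← hμ.map_mul_left V hV]
  rw [integral_map (continuous_const_mul V).measurable.aemeasurable
    (continuous_norm_sq_trace_conj _ Y).aestronglyMeasurable]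
  refine integral_congr_ae (Filter.Eventually.of_forall fun U => ?_)
  have e : (pauliPair p * ((V * U).1 * Y * star (V * U).1)).trace =
      (star V.1 * pauliPair p * V.1 * (U.1 * Y * star U.1)).trace := by
    have : pauliPair p * ((V * U).1 * Y * star (V * U).1) =
        (pauliPair p * V.1 * (U.1 * Y * star U.1)) * star V.1 := by
      simp [mul_assoc]
    rw [this, Matrix.trace_mul_comm]
    simp only [mul_assoc]
  simp only [e]
  rcases h with h | h <;> simp [h]

theorem sum_norm_sq_trace_pauliPair_conj (U : TwoQubitUnitary)
    (Y : Matrix (Fin 2 × Fin 2) (Fin 2 × Fin 2) ℂ) :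
    ∑ p, ‖(pauliPair p * (U.1 * Y * star U.1)).trace‖ ^ 2 =
      ∑ p, ‖(pauliPair p * Y).trace‖ ^ 2 := by
  rw [sum_norm_sq_trace_mul pauliPair 4 pauliPair_completeness,
    sum_norm_sq_trace_mul pauliPair 4 pauliPair_completeness,
    sum_norm_sq_unitary_conj (Matrix.mem_unitaryGroup_iff'.mp U.2)]

theorem trace_pauliPair_zero_conj (U : TwoQubitUnitary)
    (Y : Matrix (Fin 2 × Fin 2) (Fin 2 × Fin 2) ℂ) :
    (pauliPair 0 * (U.1 * Y * star U.1)).trace = (pauliPair 0 * Y).trace := by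
  rw [pauliPair_zero, one_mul, one_mul, Matrix.trace_mul_comm, ← mul_assoc,
    Matrix.mem_unitaryGroup_iff'.mp U.2, one_mul]

/-- A Clifford-invariant gate spreads the squared Pauli coefficients evenly over the fifteen
nontrivial two-qubit Pauli operators. -/
theorem IsCliffordInvariant.integral_norm_sq_trace {μ : Measure TwoQubitUnitary}
    (hμ : IsCliffordInvariant μ) {p : Fin 4 × Fin 4} (hp : p ≠ 0)
    (Y : Matrix (Fin 2 × Fin 2) (Fin 2 × Fin 2) ℂ) :
    ∫ U, ‖(pauliPair p * (U.1 * Y * star U.1)).trace‖ ^ 2 ∂μ =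
      (∑ q ∈ Finset.univ.erase 0, ‖(pauliPair q * Y).trace‖ ^ 2) / 15 := by
  have := hμ.isProbabilityMeasure
  have hsum : ∑ q ∈ Finset.univ.erase (0 : Fin 4 × Fin 4),
      ∫ U, ‖(pauliPair q * (U.1 * Y * star U.1)).trace‖ ^ 2 ∂μ =
      ∑ q ∈ Finset.univ.erase 0, ‖(pauliPair q * Y).trace‖ ^ 2 := by
    rw [← integral_finsetSum _ fun q _ => integrable_of_continuous_of_compactSpace
      (continuous_norm_sq_trace_conj _ Y)]
    have h : ∀ U : TwoQubitUnitary, ∑ q ∈ Finset.univ.erase (0 : Fin 4 × Fin 4),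
        ‖(pauliPair q * (U.1 * Y * star U.1)).trace‖ ^ 2 =
        ∑ q ∈ Finset.univ.erase 0, ‖(pauliPair q * Y).trace‖ ^ 2 := by
      intro U
      have h1 := sum_norm_sq_trace_pauliPair_conj U Y
      rw [← Finset.add_sum_erase _ _ (Finset.mem_univ (0 : Fin 4 × Fin 4)),
        ← Finset.add_sum_erase _ _ (Finset.mem_univ (0 : Fin 4 × Fin 4)),
        trace_pauliPair_zero_conj] at h1
      exact add_left_cancel h1
    simp_rw [h]
    simp
  rw [← hsum, Finset.sum_congr rfl fun q hq => hμ.integral_eq (Finset.ne_of_mem_erase hq) hp Y]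
  rw [Finset.sum_const, Finset.card_erase_of_mem (Finset.mem_univ _)]
  simp

/-- The number of nontrivial factors of a two-qubit Pauli operator. -/
def pairWeight (p : Fin 4 × Fin 4) : ℕ := (if p.1 = 0 then 0 else 1) + (if p.2 = 0 then 0 else 1)

/-- The effect of a random gate on a function `h` of the weight, as a function of the two factors
`p` that the gate meets and the weight `w` of the other factors. Of the fifteen nontrivial pairs,
six have weight one and nine have weight two. -/
noncomputable def pairStep (h : ℕ → ℝ) (w : ℕ) (p : Fin 4 × Fin 4) : ℝ :=
  if p = 0 then h w else (2 * h (w + 1) + 3 * h (w + 2)) / 5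

theorem sum_erase_pairWeight (h : ℕ → ℝ) (w : ℕ) :
    ∑ p ∈ Finset.univ.erase (0 : Fin 4 × Fin 4), h (w + pairWeight p) =
      6 * h (w + 1) + 9 * h (w + 2) := by
  have h1 : ∑ p : Fin 4 × Fin 4, h (w + pairWeight p) = h w + (6 * h (w + 1) + 9 * h (w + 2)) := by
    simp [Fintype.sum_prod_type, Fin.sum_univ_four, pairWeight]
    ring
  rw [← Finset.add_sum_erase _ _ (Finset.mem_univ (0 : Fin 4 × Fin 4))] at h1
  have h2 : pairWeight 0 = 0 := rfl
  rw [h2, add_zero] at h1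
  exact add_left_cancel h1

theorem IsCliffordInvariant.integral_sum_pauliPair {μ : Measure TwoQubitUnitary}
    (hμ : IsCliffordInvariant μ) (h : ℕ → ℝ) (w : ℕ)
    (Y : Matrix (Fin 2 × Fin 2) (Fin 2 × Fin 2) ℂ) :
    ∫ U, ∑ p, h (w + pairWeight p) * ‖(pauliPair p * (U.1 * Y * star U.1)).trace‖ ^ 2 ∂μ =
      ∑ p, pairStep h w p * ‖(pauliPair p * Y).trace‖ ^ 2 := by
  have := hμ.isProbabilityMeasure
  rw [integral_finsetSum _ fun q _ => (integrable_of_continuous_of_compactSpace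
      (continuous_norm_sq_trace_conj _ Y)).const_mul _]
  simp_rw [integral_const_mul]
  rw [← Finset.add_sum_erase _ _ (Finset.mem_univ (0 : Fin 4 × Fin 4)),
    ← Finset.add_sum_erase _ _ (Finset.mem_univ (0 : Fin 4 × Fin 4))]
  have h2 : pairWeight 0 = 0 := rfl
  congr 1
  · simp_rw [trace_pauliPair_zero_conj]
    simp [h2, pairStep]
  · rw [Finset.sum_congr rfl fun q hq => by
      rw [hμ.integral_norm_sq_trace (Finset.ne_of_mem_erase hq) Y]]
    rw [← Finset.sum_mul, sum_erase_pairWeight, mul_div_assoc', mul_comm, ← mul_div_assoc',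
      Finset.sum_mul]
    refine Finset.sum_congr rfl fun q hq => ?_
    rw [pairStep, if_neg (Finset.ne_of_mem_erase hq)]
    ring

/-! ### Pauli strings on many qubits -/

/-- The Pauli string `⨂ᵢ σ_{ν i}`. -/
noncomputable def pauliString {ι : Type*} [Fintype ι] (ν : ι → Fin 4) :
    Matrix (ι → Fin 2) (ι → Fin 2) ℂ :=
  Matrix.of fun x y => ∏ i, pauli (ν i) (x i) (y i)

/-- The number of nontrivial factors of a Pauli string. -/
def weight {ι : Type*} [Fintype ι] (ν : ι → Fin 4) : ℕ := ∑ i, if ν i = 0 then 0 else 1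

theorem pauliString_completeness {ι : Type*} [Fintype ι] [DecidableEq ι] (x y x' y' : ι → Fin 2) :
    ∑ ν, pauliString ν x y * star (pauliString ν x' y') =
      if x = x' ∧ y = y' then ((2 ^ Fintype.card ι : ℝ) : ℂ) else 0 := by
  have h : ∀ ν : ι → Fin 4, pauliString ν x y * star (pauliString ν x' y') =
      ∏ i, (pauli (ν i) (x i) (y i) * star (pauli (ν i) (x' i) (y' i))) := by
    intro ν
    simp only [pauliString, Matrix.of_apply, star_prod, Finset.prod_mul_distrib]
  simp_rw [h]
  rw [← Fintype.prod_sum fun i a => pauli a (x i) (y i) * star (pauli a (x' i) (y' i))]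
  simp_rw [pauli_completeness]
  split_ifs with hxy
  · obtain ⟨rfl, rfl⟩ := hxy
    simp
  · have : ∃ i, ¬ (x i = x' i ∧ y i = y' i) := by
      by_contra hcon
      push Not at hcon
      exact hxy ⟨funext fun i => (hcon i).1, funext fun i => (hcon i).2⟩
    obtain ⟨i, hi⟩ := this
    exact Finset.prod_eq_zero (Finset.mem_univ i) (if_neg hi)

theorem sum_norm_sq_trace_pauliString {ι : Type*} [Fintype ι] [DecidableEq ι]
    (X : Matrix (ι → Fin 2) (ι → Fin 2) ℂ) :
    ∑ ν, ‖(pauliString ν * X).trace‖ ^ 2 = 2 ^ Fintype.card ι * ∑ x, ∑ y, ‖X x y‖ ^ 2 :=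
  sum_norm_sq_trace_mul pauliString _ pauliString_completeness X

theorem pauliString_zero {ι : Type*} [Fintype ι] [DecidableEq ι] :
    pauliString (0 : ι → Fin 4) = 1 := by
  ext x y
  simp only [pauliString, Matrix.of_apply, Pi.zero_apply, Matrix.one_apply]
  have h : ∀ i, pauli 0 (x i) (y i) = if x i = y i then 1 else 0 := fun i => by
    simp [pauli, Matrix.one_apply]
  simp_rw [h]
  rw [Finset.prod_ite_zero]
  simp [funext_iff]

theorem pauliString_isHermitian {ι : Type*} [Fintype ι] (ν : ι → Fin 4) :
    (pauliString ν)ᴴ = pauliString ν := by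
  ext x y
  simp only [pauliString, Matrix.conjTranspose_apply, Matrix.of_apply, star_prod]
  refine Finset.prod_congr rfl fun i _ => ?_
  conv_rhs => rw [← pauli_isHermitian (ν i)]
  rfl

theorem pauli_mul_self (a : Fin 4) : pauli a * pauli a = 1 := by
  have h0 : pauli 0 = 1 := rfl
  have h1 : ∀ a, pauliPhase a a = 0 := by decide
  have h2 : ∀ a, pauliMul a a = 0 := by decide
  rw [pauli_mul, h1, h2, pow_zero, one_smul, h0]

theorem pauliString_mul_self {ι : Type*} [Fintype ι] [DecidableEq ι] (ν : ι → Fin 4) :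
    pauliString ν * pauliString ν = 1 := by
  ext x z
  simp only [pauliString, Matrix.mul_apply, Matrix.of_apply, ← Finset.prod_mul_distrib]
  rw [← Fintype.prod_sum fun i b => pauli (ν i) (x i) b * pauli (ν i) b (z i)]
  have h : ∀ i, ∑ b, pauli (ν i) (x i) b * pauli (ν i) b (z i) = if x i = z i then 1 else 0 := by
    intro i
    rw [← Matrix.mul_apply, pauli_mul_self, Matrix.one_apply]
  simp_rw [h]
  rw [Finset.prod_ite_zero, Matrix.one_apply]
  simp [funext_iff]

theorem sum_filter_weight_eq (n x : ℕ) :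
    ((Finset.univ.filter fun ν : Fin n → Fin 4 => weight ν = x).card : ℝ) = stringCount n x := by
  classical
  -- the generating function of the weight factorizes over the sites
  have h : ∑ ν : Fin n → Fin 4, (Polynomial.X : Polynomial ℝ) ^ weight ν =
      (1 + 3 * Polynomial.X) ^ n := by
    have h1 : ∀ ν : Fin n → Fin 4, (Polynomial.X : Polynomial ℝ) ^ weight ν =
        ∏ i, if ν i = 0 then 1 else Polynomial.X := by
      intro ν
      unfold weight
      rw [← Finset.prod_pow_eq_pow_sum]
      refine Finset.prod_congr rfl fun i _ => ?_
      split_ifs <;> simp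
    simp_rw [h1]
    rw [← Fintype.prod_sum fun (_ : Fin n) (a : Fin 4) =>
      if a = 0 then (1 : Polynomial ℝ) else Polynomial.X]
    simp [Fin.sum_univ_four]
    ring
  have h2 := congrArg (fun p => Polynomial.coeff p x) h
  simp only [Polynomial.finsetSum_coeff, Polynomial.coeff_X_pow] at h2
  have h3 : (1 + 3 * Polynomial.X : Polynomial ℝ) ^ n =
      ∑ m ∈ Finset.range (n + 1), Polynomial.C (3 ^ m * (n.choose m : ℝ)) * Polynomial.X ^ m := by
    rw [add_comm, add_pow]
    refine Finset.sum_congr rfl fun m _ => ?_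
    have h3' : (3 : Polynomial ℝ) = Polynomial.C 3 := rfl
    rw [one_pow, mul_one, mul_pow, h3', ← Polynomial.C_pow, Polynomial.C_mul]
    rw [Polynomial.C_eq_natCast]
    ring
  rw [h3] at h2
  simp only [Polynomial.finsetSum_coeff, Polynomial.coeff_C_mul_X_pow] at h2
  rw [Finset.sum_ite_eq] at h2
  rw [Finset.card_filter]
  push_cast
  have h4 : ∀ ν : Fin n → Fin 4, (if weight ν = x then (1 : ℝ) else 0) =
      if x = weight ν then 1 else 0 := fun ν => by simp only [eq_comm]
  simp_rw [h4, h2]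
  unfold stringCount
  split_ifs with h5
  · rfl
  · rw [Nat.choose_eq_zero_of_lt (by simpa using h5)]
    simp

theorem weight_le (n : ℕ) (ν : Fin n → Fin 4) : weight ν ≤ n := by
  unfold weight
  refine (Finset.sum_le_sum fun i _ =>
    show (if ν i = 0 then 0 else 1) ≤ 1 by split_ifs <;> simp).trans ?_
  simp

theorem weight_eq_zero_iff {ι : Type*} [Fintype ι] (ν : ι → Fin 4) : weight ν = 0 ↔ ν = 0 := by
  unfold weight
  rw [Finset.sum_eq_zero_iff]
  simp [funext_iff]

/-! ### Singling out two qubits -/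

/-- A labelling of `n` sites as the labels of the sites `i`, `j` and those of the other sites. -/
def splitPair {n : ℕ} (α : Type*) {i j : Fin n} (hij : i ≠ j) :
    (Fin n → α) ≃ (α × α) × ({k // k ≠ i ∧ k ≠ j} → α) where
  toFun x := ((x i, x j), fun k => x k)
  invFun q k := if h : k ≠ i ∧ k ≠ j then q.2 ⟨k, h⟩ else if k = i then q.1.1 else q.1.2
  left_inv x := by
    funext k
    by_cases h1 : k = i
    · subst h1; simp
    · by_cases h2 : k = j
      · subst h2; simp [h1]
      · simp [h1, h2]
  right_inv q := by
    obtain ⟨⟨a, b⟩, c⟩ := q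
    have hji : j ≠ i := hij.symm
    refine Prod.ext (Prod.ext ?_ ?_) ?_
    · simp
    · simp [hji]
    · funext k
      simp [k.2.1, k.2.2]

@[to_additive]
theorem prod_splitPair {n : ℕ} {i j : Fin n} (hij : i ≠ j) {M : Type*} [CommMonoid M]
    (g : Fin n → M) : ∏ k, g k = g i * g j * ∏ k : {k // k ≠ i ∧ k ≠ j}, g k := by
  rw [← Finset.prod_subtype (Finset.univ.filter fun k => k ≠ i ∧ k ≠ j) (by simp) g]
  have h : (Finset.univ.filter fun k => k ≠ i ∧ k ≠ j) = (Finset.univ.erase i).erase j := by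
    ext k
    simp [and_comm]
  rw [h, mul_assoc, Finset.mul_prod_erase _ _ (by simp [hij.symm]),
    Finset.mul_prod_erase _ _ (Finset.mem_univ i)]

theorem weight_splitPair {n : ℕ} {i j : Fin n} (hij : i ≠ j) (ν : Fin n → Fin 4) :
    weight ν = weight (splitPair _ hij ν).2 + pairWeight (splitPair _ hij ν).1 := by
  unfold weight pairWeight
  rw [sum_splitPair hij, add_comm]
  rfl

theorem pauliString_submatrix_splitPair {n : ℕ} {i j : Fin n} (hij : i ≠ j) (ν : Fin n → Fin 4) :
    (pauliString ν).submatrix (splitPair _ hij).symm (splitPair _ hij).symm =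
      pauliPair (splitPair _ hij ν).1 ⊗ₖ pauliString (splitPair _ hij ν).2 := by
  ext p q
  obtain ⟨x, rfl⟩ := (splitPair (Fin 2) hij).surjective p
  obtain ⟨y, rfl⟩ := (splitPair (Fin 2) hij).surjective q
  rw [Matrix.submatrix_apply, Equiv.symm_apply_apply, Equiv.symm_apply_apply]
  simp only [pauliString, Matrix.of_apply, Matrix.kroneckerMap_apply, pauliPair]
  rw [prod_splitPair hij]
  rfl

theorem gateAt_submatrix_splitPair {n : ℕ} {i j : Fin n} (hij : i ≠ j)
    (U : Matrix (Fin 2 × Fin 2) (Fin 2 × Fin 2) ℂ) :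
    (gateAt i j U).submatrix (splitPair _ hij).symm (splitPair _ hij).symm = U ⊗ₖ 1 := by
  ext p q
  obtain ⟨x, rfl⟩ := (splitPair (Fin 2) hij).surjective p
  obtain ⟨y, rfl⟩ := (splitPair (Fin 2) hij).surjective q
  rw [Matrix.submatrix_apply, Equiv.symm_apply_apply, Equiv.symm_apply_apply]
  simp only [gateAt, Matrix.of_apply, Matrix.kroneckerMap_apply, Matrix.one_apply, mul_ite, mul_one,
    mul_zero]
  have h : (splitPair (Fin 2) hij x).2 = (splitPair (Fin 2) hij y).2 ↔
      ∀ k, k ≠ i → k ≠ j → x k = y k := by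
    simp [splitPair, funext_iff]
  simp only [h]
  rfl

/-- The partial trace over the second tensor factor. -/
noncomputable def partialTrace {a r : Type*} [Fintype r] (Z : Matrix (a × r) (a × r) ℂ) :
    Matrix a a ℂ :=
  Matrix.of fun x y => ∑ k, Z (x, k) (y, k)

theorem trace_partialTrace {a r : Type*} [Fintype a] [Fintype r] (Z : Matrix (a × r) (a × r) ℂ) :
    (partialTrace Z).trace = Z.trace := by
  simp [partialTrace, Matrix.trace, Fintype.sum_prod_type]

theorem partialTrace_kronecker_one_mul {a r : Type*} [Fintype a] [Fintype r] [DecidableEq r]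
    (A : Matrix a a ℂ) (Z : Matrix (a × r) (a × r) ℂ) :
    partialTrace ((A ⊗ₖ (1 : Matrix r r ℂ)) * Z) = A * partialTrace Z := by
  ext x y
  simp only [partialTrace, Matrix.of_apply, Matrix.mul_apply, Fintype.sum_prod_type,
    Matrix.kroneckerMap_apply, Matrix.one_apply, mul_ite, mul_one, mul_zero, ite_mul, zero_mul,
    Finset.sum_ite_eq, Finset.mem_univ, if_true, Finset.mul_sum]
  rw [Finset.sum_comm]

theorem partialTrace_mul_kronecker_one {a r : Type*} [Fintype a] [Fintype r] [DecidableEq r]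
    (A : Matrix a a ℂ) (Z : Matrix (a × r) (a × r) ℂ) :
    partialTrace (Z * (A ⊗ₖ (1 : Matrix r r ℂ))) = partialTrace Z * A := by
  ext x y
  simp only [partialTrace, Matrix.of_apply, Matrix.mul_apply, Fintype.sum_prod_type,
    Matrix.kroneckerMap_apply, Matrix.one_apply, mul_ite, mul_one, mul_zero,
    Finset.sum_ite_eq', Finset.mem_univ, if_true, Finset.sum_mul]
  rw [Finset.sum_comm]

theorem trace_kronecker_mul_conj {a r : Type*} [Fintype a] [Fintype r] [DecidableEq a] [DecidableEq r]
    (P U : Matrix a a ℂ) (T : Matrix r r ℂ)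
    (Z : Matrix (a × r) (a × r) ℂ) :
    ((P ⊗ₖ T) * ((U ⊗ₖ (1 : Matrix r r ℂ)) * Z * (U ⊗ₖ (1 : Matrix r r ℂ))ᴴ)).trace =
      (P * (U * partialTrace (((1 : Matrix a a ℂ) ⊗ₖ T) * Z) * star U)).trace := by
  have e : (P ⊗ₖ T) * ((U ⊗ₖ (1 : Matrix r r ℂ)) * Z * (U ⊗ₖ (1 : Matrix r r ℂ))ᴴ) =
      (P ⊗ₖ (1 : Matrix r r ℂ)) * ((U ⊗ₖ (1 : Matrix r r ℂ)) *
        (((1 : Matrix a a ℂ) ⊗ₖ T) * Z) * (star U ⊗ₖ (1 : Matrix r r ℂ))) := by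
    rw [Matrix.conjTranspose_kronecker, Matrix.conjTranspose_one, ← Matrix.star_eq_conjTranspose]
    simp only [← mul_assoc, ← Matrix.mul_kronecker_mul, one_mul, mul_one]
  rw [e, ← trace_partialTrace, partialTrace_kronecker_one_mul, partialTrace_mul_kronecker_one,
    partialTrace_kronecker_one_mul]

theorem trace_kronecker_mul {a r : Type*} [Fintype a] [Fintype r] [DecidableEq a] [DecidableEq r]
    (P : Matrix a a ℂ) (T : Matrix r r ℂ) (Z : Matrix (a × r) (a × r) ℂ) :
    ((P ⊗ₖ T) * Z).trace = (P * partialTrace (((1 : Matrix a a ℂ) ⊗ₖ T) * Z)).trace := by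
  have := trace_kronecker_mul_conj P 1 T Z
  simpa using this

/-- A Pauli coefficient after a gate on the qubits `i`, `j` is a two-qubit Pauli coefficient of a
conjugated two-qubit matrix, which depends on the string only through its other factors. -/
theorem trace_pauliString_gateAt_conj {n : ℕ} {i j : Fin n} (hij : i ≠ j) (ν : Fin n → Fin 4)
    (U : Matrix (Fin 2 × Fin 2) (Fin 2 × Fin 2) ℂ)
    (X : Matrix (Fin n → Fin 2) (Fin n → Fin 2) ℂ) :
    (pauliString ν * (gateAt i j U * X * (gateAt i j U)ᴴ)).trace =
      (pauliPair (splitPair _ hij ν).1 * (U * partialTrace (((1 : Matrix _ _ ℂ) ⊗ₖ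
        pauliString (splitPair _ hij ν).2) *
          X.submatrix (splitPair _ hij).symm (splitPair _ hij).symm) * star U)).trace := by
  rw [← trace_kronecker_mul_conj, ← pauliString_submatrix_splitPair,
    ← gateAt_submatrix_splitPair hij, Matrix.conjTranspose_submatrix, Matrix.submatrix_mul_equiv,
    Matrix.submatrix_mul_equiv, Matrix.submatrix_mul_equiv]
  simp only [Matrix.trace, Matrix.diag_apply, Matrix.submatrix_apply]
  exact ((splitPair (Fin 2) hij).symm.sum_comp _).symm

theorem trace_pauliString_mul {n : ℕ} {i j : Fin n} (hij : i ≠ j) (ν : Fin n → Fin 4)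
    (X : Matrix (Fin n → Fin 2) (Fin n → Fin 2) ℂ) :
    (pauliString ν * X).trace =
      (pauliPair (splitPair _ hij ν).1 * partialTrace (((1 : Matrix _ _ ℂ) ⊗ₖ
        pauliString (splitPair _ hij ν).2) *
          X.submatrix (splitPair _ hij).symm (splitPair _ hij).symm)).trace := by
  rw [← trace_kronecker_mul, ← pauliString_submatrix_splitPair, Matrix.submatrix_mul_equiv]
  simp only [Matrix.trace, Matrix.diag_apply, Matrix.submatrix_apply]
  exact ((splitPair (Fin 2) hij).symm.sum_comp _).symm

/-- The squared Pauli coefficients of `X`, weighted by a function `h` of the weight. -/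
noncomputable def weightedPauliSum {n : ℕ} (h : ℕ → ℝ)
    (X : Matrix (Fin n → Fin 2) (Fin n → Fin 2) ℂ) : ℝ :=
  ∑ ν : Fin n → Fin 4, h (weight ν) * ‖(pauliString ν * X).trace‖ ^ 2

/-- One random gate on a fixed pair of qubits acts on weighted Pauli sums through `pairStep`. -/
theorem IsCliffordInvariant.integral_weightedPauliSum_gateAt {μ : Measure TwoQubitUnitary}
    (hμ : IsCliffordInvariant μ) {n : ℕ} {i j : Fin n} (hij : i ≠ j) (h : ℕ → ℝ)
    (X : Matrix (Fin n → Fin 2) (Fin n → Fin 2) ℂ) :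
    ∫ U : TwoQubitUnitary, weightedPauliSum h (gateAt i j U.1 * X * (gateAt i j U.1)ᴴ) ∂μ =
      ∑ ν : Fin n → Fin 4, pairStep h (weight (splitPair _ hij ν).2) (splitPair _ hij ν).1 *
        ‖(pauliString ν * X).trace‖ ^ 2 := by
  have := hμ.isProbabilityMeasure
  set Y : ({k // k ≠ i ∧ k ≠ j} → Fin 4) → Matrix (Fin 2 × Fin 2) (Fin 2 × Fin 2) ℂ := fun τ =>
    partialTrace (((1 : Matrix _ _ ℂ) ⊗ₖ pauliString τ) *
          X.submatrix (splitPair _ hij).symm (splitPair _ hij).symm) with hY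
  have h1 : ∀ U : TwoQubitUnitary, weightedPauliSum h (gateAt i j U.1 * X * (gateAt i j U.1)ᴴ) =
      ∑ τ : {k // k ≠ i ∧ k ≠ j} → Fin 4, ∑ p, h (weight τ + pairWeight p) *
        ‖(pauliPair p * (U.1 * Y τ * star U.1)).trace‖ ^ 2 := by
    intro U
    unfold weightedPauliSum
    rw [← (splitPair (Fin 4) hij).symm.sum_comp, Fintype.sum_prod_type, Finset.sum_comm]
    refine Finset.sum_congr rfl fun τ _ => Finset.sum_congr rfl fun p _ => ?_
    rw [trace_pauliString_gateAt_conj hij, weight_splitPair hij, Equiv.apply_symm_apply]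
  simp_rw [h1]
  rw [integral_finsetSum _ fun τ _ => integrable_finsetSum _ fun p _ =>
    (integrable_of_continuous_of_compactSpace (continuous_norm_sq_trace_conj _ _)).const_mul _]
  simp_rw [hμ.integral_sum_pauliPair]
  rw [← (splitPair (Fin 4) hij).symm.sum_comp, Fintype.sum_prod_type, Finset.sum_comm]
  refine Finset.sum_congr rfl fun p _ => Finset.sum_congr rfl fun τ _ => ?_
  rw [trace_pauliString_mul hij, Equiv.apply_symm_apply]

/-! ### The average over the pair of qubits -/

/-- The real-valued indicator function of the support of a Pauli string. -/
noncomputable def supportInd {n : ℕ} (ν : Fin n → Fin 4) (i : Fin n) : ℝ :=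
  if ν i = 0 then 0 else 1

theorem sum_supportInd {n : ℕ} (ν : Fin n → Fin 4) : ∑ i, supportInd ν i = weight ν := by
  unfold weight supportInd
  push_cast
  rfl

theorem two_mul_sum_pairs {n : ℕ} (F : Fin n → Fin n → ℝ) (hF : ∀ i j, F i j = F j i) :
    2 * ∑ p : {p : Fin n × Fin n // p.1 < p.2}, F p.1.1 p.1.2 + ∑ i, F i i =
      ∑ i, ∑ j, F i j := by
  have h1 : ∑ p : {p : Fin n × Fin n // p.1 < p.2}, F p.1.1 p.1.2 =
      ∑ i, ∑ j, if i < j then F i j else 0 := by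
    rw [← Finset.sum_subtype (Finset.univ.filter fun p : Fin n × Fin n => p.1 < p.2) (by simp)
      fun p => F p.1 p.2]
    rw [Finset.sum_filter, Fintype.sum_prod_type]
  have h2 : ∑ i, ∑ j, (if i < j then F i j else 0) = ∑ i, ∑ j, if j < i then F i j else 0 := by
    rw [Finset.sum_comm]
    refine Finset.sum_congr rfl fun i _ => Finset.sum_congr rfl fun j _ => ?_
    rw [hF]
  have h3 : ∑ i, F i i = ∑ i, ∑ j, if i = j then F i j else 0 := by simp
  rw [two_mul]
  nth_rewrite 2 [h1]
  rw [h2, h1, h3, ← Finset.sum_add_distrib, ← Finset.sum_add_distrib]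
  refine Finset.sum_congr rfl fun i _ => ?_
  rw [← Finset.sum_add_distrib, ← Finset.sum_add_distrib]
  refine Finset.sum_congr rfl fun j _ => ?_
  rcases lt_trichotomy i j with h | h | h
  · simp [h, h.not_gt, h.ne]
  · simp [h]
  · simp [h, h.not_gt, h.ne']

theorem card_pairs (n : ℕ) :
    (Fintype.card {p : Fin n × Fin n // p.1 < p.2} : ℝ) = n * (n - 1) / 2 := by
  have h := two_mul_sum_pairs (n := n) (fun _ _ => 1) (fun _ _ => rfl)
  simp only [Finset.sum_const, Finset.card_univ, nsmul_eq_mul, mul_one, Fintype.card_fin] at h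
  linarith

/-- `pairStep` as a polynomial in the indicators of the support at `i` and `j`, ready for summation
over the pairs. -/
theorem pairStep_splitPair {n : ℕ} {i j : Fin n} (hij : i ≠ j) (h : ℕ → ℝ) (ν : Fin n → Fin 4) :
    pairStep h (weight (splitPair _ hij ν).2) (splitPair _ hij ν).1 =
      h (weight ν) + (supportInd ν i + supportInd ν j - 2 * (supportInd ν i * supportInd ν j)) *
          (3 / 5 * (h (weight ν + 1) - h (weight ν))) +
        supportInd ν i * supportInd ν j * (2 / 5 * (h (weight ν - 1) - h (weight ν))) := by
  rw [weight_splitPair hij ν]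
  have e : (splitPair (Fin 4) hij ν).1 = (ν i, ν j) := rfl
  rw [e]
  set w := weight (splitPair (Fin 4) hij ν).2
  unfold pairStep pairWeight supportInd
  by_cases hi : ν i = 0 <;> by_cases hj : ν j = 0 <;> simp [hi, hj, Prod.ext_iff] <;> ring_nf

theorem sum_pairs_pairStep {n : ℕ} (hn : 2 ≤ n) (h : ℕ → ℝ) (ν : Fin n → Fin 4) :
    (∑ p : {p : Fin n × Fin n // p.1 < p.2},
      pairStep h (weight (splitPair _ p.2.ne ν).2) (splitPair _ p.2.ne ν).1) =
        n * (n - 1) / 2 * weightStep n h (weight ν) := by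
  have hnR : (2 : ℝ) ≤ n := by exact_mod_cast hn
  simp_rw [pairStep_splitPair]
  have hsq : ∀ i, supportInd ν i * supportInd ν i = supportInd ν i := by
    intro i
    unfold supportInd
    split_ifs <;> simp
  have h1 := two_mul_sum_pairs (n := n) (fun i j => supportInd ν i + supportInd ν j)
    (fun i j => add_comm _ _)
  have h2 := two_mul_sum_pairs (n := n) (fun i j => supportInd ν i * supportInd ν j)
    (fun i j => mul_comm _ _)
  simp only [hsq, Finset.sum_add_distrib, Finset.sum_const, Finset.card_univ, Fintype.card_fin,
    nsmul_eq_mul, ← Finset.mul_sum, ← Finset.sum_mul, sum_supportInd] at h1 h2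
  simp only [Finset.sum_add_distrib, ← Finset.sum_mul, Finset.sum_sub_distrib, ← Finset.mul_sum,
    Finset.sum_const, Finset.card_univ, nsmul_eq_mul, card_pairs] at h1 h2 ⊢
  unfold weightStep upRate downRate
  set A := ∑ p : {p : Fin n × Fin n // p.1 < p.2}, supportInd ν p.1.1
  set B := ∑ p : {p : Fin n × Fin n // p.1 < p.2}, supportInd ν p.1.2
  set D := ∑ p : {p : Fin n × Fin n // p.1 < p.2}, supportInd ν p.1.1 * supportInd ν p.1.2
  have hAB : A + B = n * weight ν - weight ν := by linarith
  have hD : D = (weight ν * weight ν - weight ν) / 2 := by linarith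
  have h0 : (n : ℝ) ≠ 0 := by linarith
  have h01 : (n : ℝ) - 1 ≠ 0 := by linarith
  rw [hAB, hD]
  field_simp
  ring

/-! ### One random step and the whole circuit -/

instance instSecondCountableTopologyTwoQubitUnitary : SecondCountableTopology TwoQubitUnitary :=
  have : SecondCountableTopology (Matrix (Fin 2 × Fin 2) (Fin 2 × Fin 2) ℂ) :=
    inferInstanceAs (SecondCountableTopology (Fin 2 × Fin 2 → Fin 2 × Fin 2 → ℂ))
  Topology.IsEmbedding.subtypeVal.secondCountableTopology

theorem continuous_gateAt {n : ℕ} (i j : Fin n) :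
    Continuous fun U : Matrix (Fin 2 × Fin 2) (Fin 2 × Fin 2) ℂ => gateAt i j U := by
  refine continuous_matrix fun x y => ?_
  simp only [gateAt, Matrix.of_apply]
  split_ifs
  · exact continuous_id.matrix_elem _ _
  · exact continuous_const

theorem continuous_stepGate (n : ℕ) :
    Continuous fun s : Step n => gateAt s.1.1.1 s.1.1.2 s.2.1 := by
  rw [continuous_prod_of_discrete_left]
  intro p
  exact (continuous_gateAt p.1.1 p.1.2).comp continuous_subtype_val

theorem continuous_circuitUnitary (n t : ℕ) :
    Continuous fun ω : Fin t → Step n => circuitUnitary t ω := by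
  induction t with
  | zero => exact continuous_const
  | succ t ih =>
    exact ((continuous_stepGate n).comp (continuous_apply (Fin.last t))).matrix_mul
      (ih.comp (continuous_pi fun s => continuous_apply s.castSucc))

theorem continuous_evolvedState {n : ℕ} (t : ℕ) (ρ : Matrix (Fin n → Fin 2) (Fin n → Fin 2) ℂ) :
    Continuous fun ω : Fin t → Step n => evolvedState ω ρ :=
  ((continuous_circuitUnitary n t).matrix_mul continuous_const).matrix_mul
    (continuous_circuitUnitary n t).matrix_conjTranspose

theorem continuous_weightedPauliSum {n : ℕ} (h : ℕ → ℝ) :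
    Continuous fun X : Matrix (Fin n → Fin 2) (Fin n → Fin 2) ℂ => weightedPauliSum h X := by
  unfold weightedPauliSum
  refine continuous_finsetSum _ fun ν _ => continuous_const.mul ?_
  exact ((continuous_const.matrix_mul continuous_id).matrix_trace.norm).pow 2

theorem nonempty_pairs {n : ℕ} (hn : 2 ≤ n) : Nonempty {p : Fin n × Fin n // p.1 < p.2} :=
  ⟨⟨(⟨0, by omega⟩, ⟨1, by omega⟩), by simp⟩⟩

theorem isProbabilityMeasure_stepMeasure {n : ℕ} (hn : 2 ≤ n) {μ : Measure TwoQubitUnitary}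
    (hμ : IsCliffordInvariant μ) : IsProbabilityMeasure (stepMeasure n μ) := by
  have := nonempty_pairs hn
  have := hμ.isProbabilityMeasure
  unfold stepMeasure
  infer_instance

theorem integral_uniformOn_univ {α : Type*} [Fintype α] [MeasurableSpace α]
    [MeasurableSingletonClass α] (g : α → ℝ) :
    ∫ a, g a ∂(ProbabilityTheory.uniformOn Set.univ) = (∑ a, g a) / Fintype.card α := by
  rw [integral_fintype .of_finite, Finset.sum_div]
  refine Finset.sum_congr rfl fun a _ => ?_
  rw [measureReal_def, ProbabilityTheory.uniformOn_univ, Measure.count_singleton]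
  simp [div_eq_inv_mul]

/-- One random step acts on weighted Pauli sums through the weight chain. -/
theorem IsCliffordInvariant.integral_step {μ : Measure TwoQubitUnitary}
    (hμ : IsCliffordInvariant μ) {n : ℕ} (hn : 2 ≤ n) (h : ℕ → ℝ)
    (X : Matrix (Fin n → Fin 2) (Fin n → Fin 2) ℂ) :
    ∫ s : Step n, weightedPauliSum h
        (gateAt s.1.1.1 s.1.1.2 s.2.1 * X * (gateAt s.1.1.1 s.1.1.2 s.2.1)ᴴ) ∂(stepMeasure n μ) =
      weightedPauliSum (weightStep n h) X := by
  have := nonempty_pairs hn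
  have := hμ.isProbabilityMeasure
  have hnR : (2 : ℝ) ≤ n := by exact_mod_cast hn
  have hcont : Continuous fun s : Step n => weightedPauliSum h
        (gateAt s.1.1.1 s.1.1.2 s.2.1 * X * (gateAt s.1.1.1 s.1.1.2 s.2.1)ᴴ) :=
    (continuous_weightedPauliSum h).comp (((continuous_stepGate n).matrix_mul
      continuous_const).matrix_mul (continuous_stepGate n).matrix_conjTranspose)
  unfold stepMeasure
  rw [integral_prod _ (integrable_of_continuous_of_compactSpace hcont), integral_uniformOn_univ]
  have h1 : ∀ p : {p : Fin n × Fin n // p.1 < p.2},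
      ∫ U : TwoQubitUnitary, weightedPauliSum h
        (gateAt p.1.1 p.1.2 U.1 * X * (gateAt p.1.1 p.1.2 U.1)ᴴ) ∂μ = _ := fun p =>
    hμ.integral_weightedPauliSum_gateAt p.2.ne h X
  simp_rw [h1]
  rw [Finset.sum_comm, Finset.sum_div]
  unfold weightedPauliSum
  refine Finset.sum_congr rfl fun ν _ => ?_
  rw [← Finset.sum_mul, sum_pairs_pairStep hn, card_pairs]
  have h0 : (n : ℝ) ≠ 0 := by linarith
  have h01 : (n : ℝ) - 1 ≠ 0 := by linarith
  field_simp

theorem evolvedState_succ {n t : ℕ} (ω : Fin (t + 1) → Step n)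
    (ρ : Matrix (Fin n → Fin 2) (Fin n → Fin 2) ℂ) :
    evolvedState ω ρ = gateAt (ω (Fin.last t)).1.1.1 (ω (Fin.last t)).1.1.2 (ω (Fin.last t)).2.1 *
      evolvedState (fun s => ω s.castSucc) ρ *
        (gateAt (ω (Fin.last t)).1.1.1 (ω (Fin.last t)).1.1.2 (ω (Fin.last t)).2.1)ᴴ := by
  simp only [evolvedState, circuitUnitary, Matrix.conjTranspose_mul, mul_assoc]

/-- The expected weighted Pauli sum of the evolved state. -/
theorem IsCliffordInvariant.integral_evolvedState {μ : Measure TwoQubitUnitary}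
    (hμ : IsCliffordInvariant μ) {n : ℕ} (hn : 2 ≤ n) (t : ℕ) (h : ℕ → ℝ)
    (ρ : Matrix (Fin n → Fin 2) (Fin n → Fin 2) ℂ) :
    ∫ ω, weightedPauliSum h (evolvedState ω ρ) ∂(circuitMeasure n t μ) =
      weightedPauliSum ((weightStep n)^[t] h) ρ := by
  have := isProbabilityMeasure_stepMeasure hn hμ
  induction t generalizing h with
  | zero =>
    unfold circuitMeasure
    have : ∀ ω : Fin 0 → Step n, weightedPauliSum h (evolvedState ω ρ) = weightedPauliSum h ρ := by
      intro ω
      simp [evolvedState, circuitUnitary]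
    simp_rw [this]
    simp
  | succ t ih =>
    rw [Function.iterate_succ_apply, ← ih (weightStep n h)]
    have hmp := (measurePreserving_piFinSuccAbove (fun _ : Fin (t + 1) => stepMeasure n μ)
      (Fin.last t)).symm
    unfold circuitMeasure
    rw [← hmp.integral_comp']
    have hc : Continuous fun q : Step n × (Fin t → Step n) => weightedPauliSum h
        (gateAt q.1.1.1.1 q.1.1.1.2 q.1.2.1 * evolvedState q.2 ρ *
          (gateAt q.1.1.1.1 q.1.1.1.2 q.1.2.1)ᴴ) :=
      (continuous_weightedPauliSum h).comp
        ((((continuous_stepGate n).comp continuous_fst).matrix_mul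
          ((continuous_evolvedState t ρ).comp continuous_snd)).matrix_mul
            ((continuous_stepGate n).comp continuous_fst).matrix_conjTranspose)
    have he : ∀ q : Step n × (Fin t → Step n), weightedPauliSum h (evolvedState
        ((MeasurableEquiv.piFinSuccAbove (fun _ => Step n) (Fin.last t)).symm q) ρ) =
        weightedPauliSum h (gateAt q.1.1.1.1 q.1.1.1.2 q.1.2.1 * evolvedState q.2 ρ *
          (gateAt q.1.1.1.1 q.1.1.1.2 q.1.2.1)ᴴ) := by
      intro q
      rw [evolvedState_succ]
      simp [MeasurableEquiv.piFinSuccAbove, Fin.insertNthEquiv]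
    simp_rw [he]
    have hint := integrable_of_continuous_of_compactSpace
      (μ := (stepMeasure n μ).prod (Measure.pi fun _ : Fin t => stepMeasure n μ)) hc
    refine (integral_prod_symm _ hint).trans ?_
    have key : ∀ ω : Fin t → Step n, ∫ s : Step n, weightedPauliSum h
        (gateAt s.1.1.1 s.1.1.2 s.2.1 * evolvedState ω ρ * (gateAt s.1.1.1 s.1.1.2 s.2.1)ᴴ)
          ∂(stepMeasure n μ) = weightedPauliSum (weightStep n h) (evolvedState ω ρ) := fun ω =>
      hμ.integral_step hn h (evolvedState ω ρ)
    simp only [key]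

/-! ### Hilbert–Schmidt bounds for density operators -/

theorem norm_sum_mul_sq_le {κ : Type*} [Fintype κ] (f g : κ → ℂ) :
    ‖∑ k, f k * g k‖ ^ 2 ≤ (∑ k, ‖f k‖ ^ 2) * ∑ k, ‖g k‖ ^ 2 := by
  calc ‖∑ k, f k * g k‖ ^ 2 ≤ (∑ k, ‖f k‖ * ‖g k‖) ^ 2 := by
        gcongr
        refine (norm_sum_le _ _).trans_eq ?_
        simp_rw [norm_mul]
    _ ≤ _ := Finset.sum_mul_sq_le_sq_mul_sq _ _ _

theorem norm_trace_mul_sq_le {d : Type*} [Fintype d] (A C : Matrix d d ℂ) :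
    ‖(A * C).trace‖ ^ 2 ≤ (∑ x, ∑ y, ‖A x y‖ ^ 2) * ∑ x, ∑ y, ‖C x y‖ ^ 2 := by
  have h := norm_sum_mul_sq_le (fun q : d × d => A q.1 q.2) (fun q => C q.2 q.1)
  rw [Fintype.sum_prod_type, Fintype.sum_prod_type, Fintype.sum_prod_type] at h
  rw [Finset.sum_comm (f := fun x y => ‖C x y‖ ^ 2)]
  simpa [Matrix.trace, Matrix.mul_apply] using h

theorem sum_norm_sq_mul_le {d : Type*} [Fintype d] (A C : Matrix d d ℂ) :
    ∑ x, ∑ y, ‖(A * C) x y‖ ^ 2 ≤ (∑ x, ∑ y, ‖A x y‖ ^ 2) * ∑ x, ∑ y, ‖C x y‖ ^ 2 := by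
  rw [Finset.sum_comm (f := fun x y => ‖C x y‖ ^ 2), Finset.sum_mul_sum]
  exact Finset.sum_le_sum fun x _ => Finset.sum_le_sum fun y _ => norm_sum_mul_sq_le _ _

theorem IsDensityOperator.exists_eq {d : Type*} [Fintype d] {ρ : Matrix d d ℂ}
    (hρ : IsDensityOperator ρ) :
    ∃ B : Matrix d d ℂ, ρ = Bᴴ * B ∧ ∑ x, ∑ y, ‖B x y‖ ^ 2 = 1 := by
  classical
  open scoped ComplexOrder MatrixOrder in
  obtain ⟨B, hB⟩ := CStarAlgebra.nonneg_iff_eq_star_mul_self.mp hρ.posSemidef.nonneg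
  refine ⟨B, hB, ?_⟩
  rw [sum_norm_sq_eq_trace, ← Matrix.star_eq_conjTranspose, ← hB, hρ.trace_eq_one, Complex.one_re]

open scoped ComplexOrder in
theorem IsDensityOperator.conjTranspose_eq {d : Type*} [Fintype d] {ρ : Matrix d d ℂ}
    (hρ : IsDensityOperator ρ) : ρᴴ = ρ :=
  hρ.posSemidef.isHermitian

theorem sum_norm_sq_conjTranspose {d : Type*} [Fintype d] (B : Matrix d d ℂ) :
    ∑ x, ∑ y, ‖Bᴴ x y‖ ^ 2 = ∑ x, ∑ y, ‖B x y‖ ^ 2 := by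
  rw [Finset.sum_comm]
  simp

theorem IsDensityOperator.sum_norm_sq_le {d : Type*} [Fintype d] {ρ : Matrix d d ℂ}
    (hρ : IsDensityOperator ρ) : ∑ x, ∑ y, ‖ρ x y‖ ^ 2 ≤ 1 := by
  obtain ⟨B, rfl, hB⟩ := hρ.exists_eq
  refine (sum_norm_sq_mul_le _ _).trans_eq ?_
  rw [sum_norm_sq_conjTranspose, hB, mul_one]

/-- Cauchy–Schwarz for `ρ = Bᴴ B`, as Pauli strings are unitary. -/
theorem IsDensityOperator.norm_sq_trace_pauliString_le {ι : Type*} [Fintype ι]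
    [DecidableEq ι] {ρ : Matrix (ι → Fin 2) (ι → Fin 2) ℂ} (hρ : IsDensityOperator ρ) (ν : ι → Fin 4) :
    ‖(pauliString ν * ρ).trace‖ ^ 2 ≤ 1 := by
  obtain ⟨B, rfl, hB⟩ := hρ.exists_eq
  rw [← mul_assoc]
  refine (norm_trace_mul_sq_le _ _).trans_eq ?_
  have h : ∑ x, ∑ y, ‖(pauliString ν * Bᴴ) x y‖ ^ 2 = ∑ x, ∑ y, ‖Bᴴ x y‖ ^ 2 := by
    rw [sum_norm_sq_eq_trace, sum_norm_sq_eq_trace, Matrix.conjTranspose_mul,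
      pauliString_isHermitian, mul_assoc, ← mul_assoc (pauliString ν), pauliString_mul_self, one_mul]
  rw [h, sum_norm_sq_conjTranspose, hB, mul_one]

/-- Splits weighted Pauli sums by weight: `w x` is the total squared coefficient of the strings of
weight `x`, and the term `h 0` is the contribution of the identity string. -/
theorem exists_weightedPauliSum_eq {n : ℕ} {ρ : Matrix (Fin n → Fin 2) (Fin n → Fin 2) ℂ}
    (hρ : IsDensityOperator ρ) :
    ∃ w : ℕ → ℝ, (∀ x, 0 ≤ w x) ∧ (∀ x, w x ≤ stringCount n x) ∧
      ∑ x ∈ Finset.range n, w (x + 1) ≤ 2 ^ n ∧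
      ∀ h : ℕ → ℝ, weightedPauliSum h ρ = h 0 + ∑ x ∈ Finset.range n, w (x + 1) * h (x + 1) := by
  set w : ℕ → ℝ := fun x => ∑ ν ∈ Finset.univ.filter fun ν : Fin n → Fin 4 => weight ν = x,
    ‖(pauliString ν * ρ).trace‖ ^ 2 with hw
  have hw0 : ∀ x, 0 ≤ w x := fun x => Finset.sum_nonneg fun ν _ => by positivity
  have hzero : w 0 = 1 := by
    have h1 : (Finset.univ.filter fun ν : Fin n → Fin 4 => weight ν = 0) = {0} := by
      ext ν
      simp [weight_eq_zero_iff]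
    simp only [hw]
    rw [h1, Finset.sum_singleton, pauliString_zero, one_mul, hρ.trace_eq_one]
    simp
  have hsplit : ∀ h : ℕ → ℝ,
      weightedPauliSum h ρ = h 0 + ∑ x ∈ Finset.range n, w (x + 1) * h (x + 1) := by
    intro h
    have h1 : weightedPauliSum h ρ = ∑ x ∈ Finset.range (n + 1), w x * h x := by
      unfold weightedPauliSum
      rw [← Finset.sum_fiberwise_of_maps_to (s := Finset.univ) (t := Finset.range (n + 1))
        (g := fun ν : Fin n → Fin 4 => weight ν)
        (fun ν _ => Finset.mem_range.mpr (Nat.lt_succ_of_le (weight_le n ν)))]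
      refine Finset.sum_congr rfl fun x _ => ?_
      rw [mul_comm, Finset.mul_sum]
      refine Finset.sum_congr rfl fun ν hν => ?_
      rw [(Finset.mem_filter.mp hν).2]
    rw [h1, Finset.sum_range_succ', hzero, one_mul, add_comm]
  refine ⟨w, hw0, fun x => ?_, ?_, hsplit⟩
  · rw [← sum_filter_weight_eq]
    refine (Finset.sum_le_sum fun ν _ => hρ.norm_sq_trace_pauliString_le ν).trans_eq ?_
    simp
  · have h1 := hsplit fun _ => 1
    simp only [mul_one] at h1
    have h2 : weightedPauliSum (fun _ => 1) ρ ≤ 2 ^ n := by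
      unfold weightedPauliSum
      simp only [one_mul]
      rw [sum_norm_sq_trace_pauliString, Fintype.card_fin]
      exact mul_le_of_le_one_right (by positivity) hρ.sum_norm_sq_le
    linarith

theorem weightStep_iterate_zero (n t : ℕ) (h : ℕ → ℝ) : (weightStep n)^[t] h 0 = h 0 := by
  induction t generalizing h with
  | zero => rfl
  | succ t ih =>
    rw [Function.iterate_succ_apply, ih]
    simp [weightStep, upRate_zero, downRate_zero]

theorem weightedPauliSum_mono {n : ℕ} {g h : ℕ → ℝ} (hgh : ∀ x, g x ≤ h x)
    (X : Matrix (Fin n → Fin 2) (Fin n → Fin 2) ℂ) :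
    weightedPauliSum g X ≤ weightedPauliSum h X :=
  Finset.sum_le_sum fun _ _ => mul_le_mul_of_nonneg_right (hgh _) (by positivity)

theorem weightStep_iterate_one (n t : ℕ) :
    (weightStep n)^[t] (fun _ => 1) = fun _ => 1 := by
  induction t with
  | zero => rfl
  | succ t ih =>
    rw [Function.iterate_succ_apply', ih]
    funext x
    exact weightStep_const n x 1

/-- The expected squared Pauli coefficients on strings of weight at most `s`, the identity string
contributing `1`. -/
theorem exists_integral_weightedPauliSum_le (k : ℕ) {f : ℝ} (hf0 : 0 ≤ f) (hf1 : f ≤ 1)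
    (hf : f * Real.log 3 + Real.binEntropy f - Real.log 3 / 2 < 0) :
    ∃ C : ℝ, 0 < C ∧ ∀ μ : Measure TwoQubitUnitary, IsCliffordInvariant μ → ∀ n : ℕ, 2 ≤ n →
      ∀ ρ : Matrix (Fin n → Fin 2) (Fin n → Fin 2) ℂ, IsDensityOperator ρ →
      ∀ t : ℕ, 240 * (k + 3) * n * Real.log n ^ 2 < t → ∀ s : ℕ, (s : ℝ) ≤ f * n →
      ∫ ω, weightedPauliSum (fun x => if x ≤ s then 1 else 0) (evolvedState ω ρ)
        ∂(circuitMeasure n t μ) ≤ 1 + C / (n : ℝ) ^ k := by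
  obtain ⟨C, hC, hCn⟩ := exists_sum_lowWeightProb_le k hf0 hf1 hf
  refine ⟨C + 2 ^ 8 * 8 ^ k, by positivity, fun μ hμ n hn ρ hρ t ht s hs => ?_⟩
  have hnR : (2 : ℝ) ≤ n := by exact_mod_cast hn
  obtain ⟨w, hw0, hw1, hw2, hw⟩ := exists_weightedPauliSum_eq hρ
  rw [add_div]
  rcases le_or_gt 8 n with h8 | h8
  · have h1 := hCn n s t h8 hs ht w hw0 hw1 hw2
    rw [hμ.integral_evolvedState hn, hw, weightStep_iterate_zero]
    unfold lowWeightProb at h1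
    have : 0 ≤ 2 ^ 8 * 8 ^ k / (n : ℝ) ^ k := by positivity
    simp only [Nat.zero_le, if_true]
    linarith
  · -- for fewer than eight qubits the total squared Pauli weight is a sufficient bound
    have := isProbabilityMeasure_stepMeasure hn hμ
    have hint : ∀ h : ℕ → ℝ, Integrable (fun ω : Fin t → Step n =>
        weightedPauliSum h (evolvedState ω ρ)) (circuitMeasure n t μ) := fun h => by
      unfold circuitMeasure
      exact integrable_of_continuous_of_compactSpace
        ((continuous_weightedPauliSum h).comp (continuous_evolvedState t ρ))
    have h1 := integral_mono (hint fun x => if x ≤ s then 1 else 0) (hint fun _ => 1) fun ω =>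
      weightedPauliSum_mono (fun x => by split_ifs <;> norm_num) (evolvedState ω ρ)
    refine h1.trans ?_
    rw [hμ.integral_evolvedState hn, weightStep_iterate_one, hw]
    simp only [mul_one]
    have h2 : (2 : ℝ) ^ n ≤ 2 ^ 8 * 8 ^ k / (n : ℝ) ^ k := by
      rw [le_div_iff₀ (by positivity)]
      have : (n : ℝ) ≤ 8 := by exact_mod_cast h8.le
      gcongr
      · norm_num
    have : 0 ≤ C / (n : ℝ) ^ k := by positivity
    linarith

/-! ### Reduced states -/

/-- The extension of a Pauli string on `S` by identities. -/
def extendString {n : ℕ} (S : Finset (Fin n)) (η : {i // i ∈ S} → Fin 4) : Fin n → Fin 4 :=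
  fun i => if h : i ∈ S then η ⟨i, h⟩ else 0

theorem extendString_injective {n : ℕ} (S : Finset (Fin n)) :
    Function.Injective (extendString S) := by
  intro η η' h
  funext i
  have := congrFun h i
  simpa [extendString, i.2] using this

theorem weight_extendString_le {n : ℕ} (S : Finset (Fin n)) (η : {i // i ∈ S} → Fin 4) :
    weight (extendString S η) ≤ S.card := by
  unfold weight
  rw [Finset.card_eq_sum_ones, ← Finset.sum_filter_add_sum_filter_not Finset.univ (· ∈ S)]
  have h2 : ∑ i ∈ Finset.univ.filter (fun i => i ∉ S),
      (if extendString S η i = 0 then 0 else 1) = 0 := by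
    refine Finset.sum_eq_zero fun i hi => ?_
    have := (Finset.mem_filter.mp hi).2
    simp [extendString, this]
  rw [h2, add_zero]
  have h3 : Finset.univ.filter (fun i => i ∈ S) = S := by simp
  rw [h3]
  exact Finset.sum_le_sum fun i _ => by split_ifs <;> simp

/-- A labelling of all sites as the labels inside and outside `S`. -/
def splitSubset {n : ℕ} (α : Type*) (S : Finset (Fin n)) :
    (Fin n → α) ≃ ({i // i ∈ S} → α) × ({i // i ∉ S} → α) :=
  Equiv.piEquivPiSubtypeProd (· ∈ S) fun _ => α

theorem pauliString_submatrix_splitSubset {n : ℕ} (S : Finset (Fin n))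
    (η : {i // i ∈ S} → Fin 4) :
    (pauliString (extendString S η)).submatrix (splitSubset _ S).symm (splitSubset _ S).symm =
      pauliString η ⊗ₖ 1 := by
  rw [← pauliString_zero]
  ext p q
  obtain ⟨x, rfl⟩ := (splitSubset (Fin 2) S).surjective p
  obtain ⟨y, rfl⟩ := (splitSubset (Fin 2) S).surjective q
  rw [Matrix.submatrix_apply, Equiv.symm_apply_apply, Equiv.symm_apply_apply]
  simp only [pauliString, Matrix.of_apply, Matrix.kroneckerMap_apply]
  rw [← Fintype.prod_subtype_mul_prod_subtype (· ∈ S)]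
  congr 1
  · refine Finset.prod_congr (Finset.ext fun _ => by simp) fun i _ => ?_
    simp [extendString, i.2, splitSubset]
  · refine Finset.prod_congr rfl fun i _ => ?_
    simp [extendString, i.2, splitSubset]

theorem reducedState_eq_partialTrace {n : ℕ} (S : Finset (Fin n))
    (X : Matrix (Fin n → Fin 2) (Fin n → Fin 2) ℂ) :
    reducedState S X =
      partialTrace (X.submatrix (splitSubset _ S).symm (splitSubset _ S).symm) := rfl

theorem trace_pauliString_reducedState {n : ℕ} (S : Finset (Fin n)) (η : {i // i ∈ S} → Fin 4)
    (X : Matrix (Fin n → Fin 2) (Fin n → Fin 2) ℂ) :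
    (pauliString η * reducedState S X).trace = (pauliString (extendString S η) * X).trace := by
  rw [reducedState_eq_partialTrace, ← partialTrace_kronecker_one_mul, trace_partialTrace,
    ← pauliString_submatrix_splitSubset, Matrix.submatrix_mul_equiv]
  simp only [Matrix.trace, Matrix.diag_apply, Matrix.submatrix_apply]
  exact (splitSubset (Fin 2) S).symm.sum_comp
    (fun x => (pauliString (extendString S η) * X) x x)

theorem reducedState_isHermitian {n : ℕ} (S : Finset (Fin n))
    {X : Matrix (Fin n → Fin 2) (Fin n → Fin 2) ℂ} (hX : Xᴴ = X) :
    (reducedState S X)ᴴ = reducedState S X := by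
  ext a b
  simp only [reducedState, Matrix.conjTranspose_apply, Matrix.of_apply, star_sum]
  refine Finset.sum_congr rfl fun c _ => ?_
  conv_rhs => rw [← hX]
  rfl

theorem trace_reducedState {n : ℕ} (S : Finset (Fin n))
    (X : Matrix (Fin n → Fin 2) (Fin n → Fin 2) ℂ) : (reducedState S X).trace = X.trace := by
  have h := trace_pauliString_reducedState S 0 X
  have h0 : extendString S 0 = 0 := by
    funext i
    simp [extendString]
  rwa [h0, pauliString_zero, pauliString_zero, one_mul, one_mul] at h

theorem purity_eq_sum_norm_sq {d : Type*} [Fintype d] {Y : Matrix d d ℂ} (hY : Yᴴ = Y) :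
    purity Y = ∑ x, ∑ y, ‖Y x y‖ ^ 2 := by
  rw [sum_norm_sq_eq_trace, hY, purity]

theorem purity_reducedState_le {n : ℕ} (S : Finset (Fin n))
    {X : Matrix (Fin n → Fin 2) (Fin n → Fin 2) ℂ} (hX : Xᴴ = X) :
    purity (reducedState S X) ≤
      1 / 2 ^ S.card * weightedPauliSum (fun x => if x ≤ S.card then 1 else 0) X := by
  have h1 := sum_norm_sq_trace_pauliString (reducedState S X)
  rw [← purity_eq_sum_norm_sq (reducedState_isHermitian S hX), Fintype.card_coe] at h1
  rw [one_div, ← div_eq_inv_mul, le_div_iff₀ (by positivity), mul_comm, ← h1]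
  simp_rw [trace_pauliString_reducedState]
  unfold weightedPauliSum
  calc ∑ η, ‖(pauliString (extendString S η) * X).trace‖ ^ 2 =
      ∑ ν ∈ Finset.univ.image (extendString S), ‖(pauliString ν * X).trace‖ ^ 2 := by
          rw [Finset.sum_image fun _ _ _ _ h => extendString_injective S h]
    _ = ∑ ν ∈ Finset.univ.image (extendString S), (if weight ν ≤ S.card then (1 : ℝ) else 0) *
        ‖(pauliString ν * X).trace‖ ^ 2 := by
      refine Finset.sum_congr rfl fun ν hν => ?_
      obtain ⟨η, -, rfl⟩ := Finset.mem_image.mp hν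
      rw [if_pos (weight_extendString_le S η), one_mul]
    _ ≤ _ := by
      refine Finset.sum_le_sum_of_subset_of_nonneg (Finset.subset_univ _) fun ν _ _ => ?_
      split_ifs <;> positivity

/-! ### The trace norm -/

open scoped MatrixOrder Matrix.Norms.L2Operator in
/-- Cauchy–Schwarz for `tr |A| = tr (1 * |A|)`. -/
theorem traceNorm_sq_le {d : Type*} [Fintype d] [DecidableEq d] (A : Matrix d d ℂ) :
    traceNorm A ^ 2 ≤ Fintype.card d * ∑ x, ∑ y, ‖A x y‖ ^ 2 := by
  have h1 := norm_trace_mul_sq_le (1 : Matrix d d ℂ) (CFC.abs A)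
  have h2 : ∑ x : d, ∑ y : d, ‖(1 : Matrix d d ℂ) x y‖ ^ 2 = Fintype.card d := by
    rw [sum_norm_sq_eq_trace]
    simp
  have h3 : ∑ x, ∑ y, ‖CFC.abs A x y‖ ^ 2 = ∑ x, ∑ y, ‖A x y‖ ^ 2 := by
    rw [sum_norm_sq_eq_trace, sum_norm_sq_eq_trace, ← Matrix.star_eq_conjTranspose,
      (CFC.abs_nonneg A).isSelfAdjoint.star_eq, CFC.abs_mul_abs, Matrix.star_eq_conjTranspose]
  rw [one_mul, h2, h3] at h1
  refine le_trans ?_ h1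
  unfold traceNorm
  rw [← sq_abs]
  gcongr
  exact Complex.abs_re_le_norm _

open scoped MatrixOrder Matrix.Norms.L2Operator in
theorem continuous_traceNorm {d : Type*} [Fintype d] [DecidableEq d] :
    Continuous fun A : Matrix d d ℂ => traceNorm A := by
  unfold traceNorm
  exact Complex.continuous_re.comp
    (CFC.continuous_abs (A := Matrix d d ℂ)).matrix_trace

theorem sum_norm_sq_sub_maximallyMixed {d : Type*} [Fintype d] [DecidableEq d] {Y : Matrix d d ℂ}
    (hY : Yᴴ = Y) (htr : Y.trace = 1) (s : ℕ) (hs : Fintype.card d = 2 ^ s) :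
    ∑ x, ∑ y, ‖(Y - (1 / 2 ^ s : ℂ) • (1 : Matrix d d ℂ)) x y‖ ^ 2 = purity Y - 1 / 2 ^ s := by
  rw [sum_norm_sq_eq_trace]
  have h1 : (Y - (1 / 2 ^ s : ℂ) • (1 : Matrix d d ℂ))ᴴ = Y - (1 / 2 ^ s : ℂ) • 1 := by
    simp [hY]
  rw [h1]
  have h2 : ((Y - (1 / 2 ^ s : ℂ) • (1 : Matrix d d ℂ)) *
      (Y - (1 / 2 ^ s : ℂ) • (1 : Matrix d d ℂ))).trace =
      (Y * Y).trace - ((1 / 2 ^ s : ℝ) : ℂ) := by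
    simp only [mul_sub, sub_mul, smul_mul_assoc, mul_smul_comm, one_mul, mul_one, Matrix.trace_sub,
      Matrix.trace_smul, htr, Matrix.trace_one, hs, smul_eq_mul]
    push_cast
    have : (2 : ℂ) ^ s ≠ 0 := pow_ne_zero _ two_ne_zero
    field_simp
    ring
  rw [h2, Complex.sub_re, Complex.ofReal_re, purity]

theorem continuous_reducedState {n : ℕ} (S : Finset (Fin n)) :
    Continuous fun X : Matrix (Fin n → Fin 2) (Fin n → Fin 2) ℂ => reducedState S X := by
  refine continuous_matrix fun a b => ?_
  simp only [reducedState, Matrix.of_apply]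
  exact continuous_finsetSum _ fun c _ => continuous_id.matrix_elem _ _

theorem evolvedState_isHermitian {n t : ℕ} (ω : Fin t → Step n)
    {ρ : Matrix (Fin n → Fin 2) (Fin n → Fin 2) ℂ} (hρ : ρᴴ = ρ) :
    (evolvedState ω ρ)ᴴ = evolvedState ω ρ := by
  simp [evolvedState, Matrix.conjTranspose_mul, hρ, mul_assoc]

theorem trace_gateAt_conj {n : ℕ} {i j : Fin n} (hij : i ≠ j) (U : TwoQubitUnitary)
    (X : Matrix (Fin n → Fin 2) (Fin n → Fin 2) ℂ) :
    (gateAt i j U.1 * X * (gateAt i j U.1)ᴴ).trace = X.trace := by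
  have h1 := trace_pauliString_gateAt_conj hij 0 U.1 X
  have h2 := trace_pauliString_mul hij 0 X
  have h0 : (splitPair (Fin 4) hij 0).1 = 0 := rfl
  rw [h0, trace_pauliPair_zero_conj, pauliString_zero, one_mul] at h1
  rw [h0, pauliString_zero, one_mul] at h2
  rw [h1, h2]

theorem trace_evolvedState {n t : ℕ} (ω : Fin t → Step n)
    (ρ : Matrix (Fin n → Fin 2) (Fin n → Fin 2) ℂ) : (evolvedState ω ρ).trace = ρ.trace := by
  induction t with
  | zero => simp [evolvedState, circuitUnitary]
  | succ t ih =>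
    rw [evolvedState_succ, trace_gateAt_conj (ω (Fin.last t)).1.2.ne, ih]

end Scrambling

open Scrambling
theorem mainTheorem1 :
    ∀ k : ℕ, ∃ c : ℝ, 0 < c ∧
      ∀ f : ℝ, 0 ≤ f → f ≤ 1 →
        f * Real.log 3 + Real.binEntropy f - Real.log 3 / 2 < 0 →
        ∃ C : ℝ, 0 < C ∧
          ∀ μ : Measure TwoQubitUnitary, (μ = haarGate ∨ μ = cliffordGate) →
          ∀ n : ℕ, 2 ≤ n →
          ∀ ρ : Matrix (Fin n → Fin 2) (Fin n → Fin 2) ℂ, IsDensityOperator ρ →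
          ∀ t : ℕ, c * n * Real.log n ^ 2 < t →
          ∀ S : Finset (Fin n), (S.card : ℝ) ≤ f * n →
            (Integrable (fun ω : Fin t → Step n => purity (reducedState S (evolvedState ω ρ)))
                (circuitMeasure n t μ) ∧
              ∫ ω, purity (reducedState S (evolvedState ω ρ)) ∂(circuitMeasure n t μ) ≤
                1 / 2 ^ S.card + 1 / 2 ^ S.card * (C / (n : ℝ) ^ k)) ∧
            (Integrable (fun ω : Fin t → Step n =>
                traceNorm (reducedState S (evolvedState ω ρ) - (1 / 2 ^ S.card : ℂ) • 1) ^ 2)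
                (circuitMeasure n t μ) ∧
              ∫ ω, traceNorm (reducedState S (evolvedState ω ρ) - (1 / 2 ^ S.card : ℂ) • 1) ^ 2
                  ∂(circuitMeasure n t μ) ≤ C / (n : ℝ) ^ k) := by
  intro k
  refine ⟨240 * (k + 3), by positivity, fun f hf0 hf1 hf => ?_⟩
  obtain ⟨C, hC, hmain⟩ := exists_integral_weightedPauliSum_le k hf0 hf1 hf
  refine ⟨C, hC, fun μ hμ' n hn ρ hρ t ht S hS => ?_⟩
  have hμ : IsCliffordInvariant μ := by
    rcases hμ' with rfl | rfl
    · exact isCliffordInvariant_haarGate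
    · exact isCliffordInvariant_cliffordGate
  have hstep := isProbabilityMeasure_stepMeasure hn hμ
  have hprob : IsProbabilityMeasure (circuitMeasure n t μ) := by
    unfold circuitMeasure
    infer_instance
  have hcont := (continuous_reducedState S).comp (continuous_evolvedState t ρ)
  have hint1 : Integrable (fun ω : Fin t → Step n => purity (reducedState S (evolvedState ω ρ)))
      (circuitMeasure n t μ) :=
    integrable_of_continuous_of_compactSpace
      (Complex.continuous_re.comp (hcont.matrix_mul hcont).matrix_trace)
  have hint2 : Integrable (fun ω : Fin t → Step n =>
      traceNorm (reducedState S (evolvedState ω ρ) - (1 / 2 ^ S.card : ℂ) • 1) ^ 2)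
      (circuitMeasure n t μ) :=
    integrable_of_continuous_of_compactSpace
      ((continuous_traceNorm.comp (hcont.sub continuous_const)).pow 2)
  have hint3 : Integrable (fun ω : Fin t → Step n =>
      weightedPauliSum (fun x => if x ≤ S.card then 1 else 0) (evolvedState ω ρ))
      (circuitMeasure n t μ) :=
    integrable_of_continuous_of_compactSpace
      ((continuous_weightedPauliSum fun x => if x ≤ S.card then 1 else 0).comp
        (continuous_evolvedState t ρ))
  have hherm : ρᴴ = ρ := hρ.conjTranspose_eq
  have hpur : ∫ ω, purity (reducedState S (evolvedState ω ρ)) ∂(circuitMeasure n t μ) ≤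
      1 / 2 ^ S.card + 1 / 2 ^ S.card * (C / (n : ℝ) ^ k) := by
    refine (integral_mono hint1 (hint3.const_mul (1 / 2 ^ S.card)) fun ω =>
      purity_reducedState_le S (evolvedState_isHermitian ω hherm)).trans ?_
    rw [integral_const_mul, ← mul_one_add]
    exact mul_le_mul_of_nonneg_left (hmain μ hμ n hn ρ hρ t ht S.card hS) (by positivity)
  refine ⟨⟨hint1, hpur⟩, hint2, ?_⟩
  have hcard : Fintype.card ({i // i ∈ S} → Fin 2) = 2 ^ S.card := by simp
  have htn : ∀ ω : Fin t → Step n,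
      traceNorm (reducedState S (evolvedState ω ρ) - (1 / 2 ^ S.card : ℂ) • 1) ^ 2 ≤
        2 ^ S.card * (purity (reducedState S (evolvedState ω ρ)) - 1 / 2 ^ S.card) := by
    intro ω
    refine (traceNorm_sq_le _).trans_eq ?_
    rw [sum_norm_sq_sub_maximallyMixed
      (reducedState_isHermitian S (evolvedState_isHermitian ω hherm))
      (by rw [trace_reducedState, trace_evolvedState, hρ.trace_eq_one]) S.card hcard, hcard]
    push_cast
    rfl
  refine (integral_mono hint2 ((hint1.sub (integrable_const _)).const_mul _) htn).trans ?_
  simp only [Pi.sub_apply]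
  rw [integral_const_mul, integral_sub hint1 (integrable_const _)]
  simp only [integral_const, probReal_univ, one_smul]
  have h2 : (2 : ℝ) ^ S.card * (1 / 2 ^ S.card + 1 / 2 ^ S.card * (C / (n : ℝ) ^ k) -
      1 / 2 ^ S.card) = C / (n : ℝ) ^ k := by
    field_simp
    ring
  rw [← h2]
  gcongr
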